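/- There is a universal constant $c>0$ such that the following holds. Let $\alpha>0$, let $(E,\mathcal E,\nu)$ be a $\sigma$-finite measure space, let $f_t\in L^\alpha(E,\mathcal E,\nu)$, $t\in\mathbb Z$, be non-negative measurable functions with $\int_E f_0^\alpha\,d\nu>0$, let $(\Gamma_i,Y_i)_{i\ge1}$ enumerate the points of a Poisson random measure on $(0,\infty)\times E$ with mean measure $\mathrm{Leb}\times\nu$, and suppose that the $\alpha$-max-stable process $$X_t=\int_E^{\vee} f_t\,dM_\nu^\alpha:=\sup_{i\ge 1}\Gamma_i^{-1/\alpha}f_t(Y_i),\qquad t\in\mathbb Z,$$ is strictly stationary. Call $(a_n)$ a normalizing sequence if $a_n\to\infty$ and $n\,P(|X_0|>a_n)\to1$. (1) The finite-dimensional distributions of $(X_t)$ are regularly varying with index $\alpha$: normalizing sequences exist, and for every $h\ge1$ there is a non-null Radon measure $\mu_h$ on $[-\infty,\infty]^h\setminus\{\mathbf 0\}$, which does not charge points with infinite components and satisfies $\mu_h(tA)=t^{-\alpha}\mu_h(A)$ for $t>0$ and Borel sets $A$, such that $n\,P(a_n^{-1}(X_1,\dots,X_h)\in\cdot)\to\mu_h$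 vaguely for every normalizing sequence $(a_n)$. For all $x=(x_1,\dots,x_h)$ with $x_i>0$, the complement of $[\mathbf 0,x]=\{y: 0\le y_i\le x_i,\ i=1,\dots,h\}$ has measure $$\mu_h\big([\mathbf 0,x]^c\big)=\frac{\int_E\max_{i=1,\dots,h}\big(f_i(y)/x_i\big)^\alpha\,\nu(dy)}{\int_E f_0^\alpha(y)\,\nu(dy)}.$$ (2) The sequence $(X_t)$ has an extremal index (a number $\theta\in[0,1]$ such that for every $\tau>0$ there is a sequence $(u_n)$ with $n\,P(X_0>u_n)\to\tau$ and $P(\max(X_1,\dots,X_n)\le u_n)\to e^{-\theta\tau}$) if and only if the limit $$\theta=\lim_{n\to\infty}\frac1n\,\frac{\int_E\max_{t=1,\dots,n}f_t^\alpha(y)\,\nu(dy)}{\int_E f_0^\alpha(y)\,\nu(dy)}$$ exists, and in this case this limit is the extremal index. (3) For $a,b>0$, $A=(a,\infty)$, $B=(b,\infty)$ and $h\ge0$, the extremogram $\gamma_{AB}(h)=\lim_{n\to\infty}n\,\mathrm{cov}\big(1_{\{X_0/a_n\in A\}},1_{\{X_h/a_n\in B\}}\big)$ exists for every normalizing sequence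 $(a_n)$ and is given by $$\gamma_{AB}(h)=\frac{\int_E f_0^\alpha(y)\wedge\big(\tfrac ab f_h(y)\big)^\alpha\,\nu(dy)}{a^\alpha\int_E f_0^\alpha(y)\,\nu(dy)},$$ and, for $h\ge1$, the tail dependence coefficient is $$\rho(h)=\lim_{x\to\infty}P(X_h>x\mid X_0>x)=\frac{\int_E f_0^\alpha(y)\wedge f_h^\alpha(y)\,\nu(dy)}{\int_E f_0^\alpha(y)\,\nu(dy)}.$$ (4) For $h\ge1$ let $\alpha_h=\sup|P(A\cap B)-P(A)P(B)|$, where the supremum is over all $A\in\sigma(X_t,\,t\le0)$ and $B\in\sigma(X_t,\,t\ge h)$. Then, with values in $[0,\infty]$ on the right-hand side, $$\alpha_h\le c\sum_{s_1=-\infty}^0\ \sum_{s_2=0}^\infty\frac{\int_E f_0^\alpha(y)\wedge f_{h+s_2-s_1}^\alpha(y)\,\nu(dy)}{\int_E f_0^\alpha(y)\,\nu(dy)},\qquad h\ge1.$$ -/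

import Mathlib

open MeasureTheory ProbabilityTheory Filter Topology Set
open scoped ENNReal NNReal

namespace MaxStable

noncomputable section

/-- The random point measure `∑ i, ε_(Γ i, Y i)` on `ℝ × E`, evaluated at the outcome `ω`. -/
def pointMeasure {Ω E : Type*} [MeasurableSpace E] (Γ : ℕ → Ω → ℝ) (Y : ℕ → Ω → E) (ω : Ω) :
    Measure (ℝ × E) :=
  Measure.sum fun i => Measure.dirac (Γ i ω, Y i ω)

/-- The intensity `Leb × ν` on `(0, ∞) × E`, viewed as a measure on `ℝ × E`. -/
def intensity {E : Type*} [MeasurableSpace E] (ν : Measure E) : Measure (ℝ × E) :=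
  ((volume : Measure ℝ).restrict (Ioi 0)).prod ν

/-- `(Γ i, Y i)`, `i ∈ ℕ`, enumerates the points of a Poisson random measure on `(0, ∞) × E` with
mean measure `Leb × ν`: counts of sets of finite intensity are Poisson distributed, and the counts
of pairwise disjoint sets are independent. (If `ν` is an infinite measure, then the first
coordinates are dense in `(0, ∞)`, so that no monotone enumeration exists; hence the order of the
enumeration is left free.) -/
structure IsPoissonPoints {Ω E : Type*} [MeasurableSpace Ω] [MeasurableSpace E]
    (P : Measure Ω) (ν : Measure E) (Γ : ℕ → Ω → ℝ) (Y : ℕ → Ω → E) : Prop where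
  measurable_fst : ∀ i, Measurable (Γ i)
  measurable_snd : ∀ i, Measurable (Y i)
  pos : ∀ i ω, 0 < Γ i ω
  poisson_count : ∀ A : Set (ℝ × E), MeasurableSet A → intensity ν A ≠ ∞ →
    P.map (fun ω => pointMeasure Γ Y ω A) =
      (poissonMeasure (intensity ν A).toNNReal).map (fun k : ℕ => (k : ℝ≥0∞))
  indep_count : ∀ (m : ℕ) (A : Fin m → Set (ℝ × E)), (∀ j, MeasurableSet (A j)) →
    Pairwise (fun j k => Disjoint (A j) (A k)) →
    iIndepFun (fun j ω => pointMeasure Γ Y ω (A j)) P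

/-- The `α`-max-stable integral `sup_i Γ_i ^ (-1/α) f(Y_i)`. The supremum is almost surely finite
for nonnegative `f ∈ L^α(ν)`. -/
def maxStableIntegral {Ω E : Type*} (α : ℝ) (Γ : ℕ → Ω → ℝ) (Y : ℕ → Ω → E) (f : E → ℝ)
    (ω : Ω) : ℝ :=
  ⨆ i : ℕ, Γ i ω ^ (-(1 / α)) * f (Y i ω)

/-- Strict stationarity of a real-valued sequence: all its shifts have the same law on `ℝ^ℤ`. -/
def IsStrictlyStationary {Ω : Type*} [MeasurableSpace Ω] (P : Measure Ω) (X : ℤ → Ω → ℝ) : Prop :=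
  ∀ k : ℤ, IdentDistrib (fun ω (t : ℤ) => X (t + k) ω) (fun ω (t : ℤ) => X t ω) P P

/-- The normalizing sequences of a random variable `Z`: `a n → ∞` and `P(|Z| > a n) ∼ 1 / n`. -/
def IsNormalizing {Ω : Type*} [MeasurableSpace Ω] (P : Measure Ω) (Z : Ω → ℝ) (a : ℕ → ℝ) : Prop :=
  Tendsto a atTop atTop ∧
    Tendsto (fun n : ℕ => (n : ℝ) * P.real {ω | a n < |Z ω|}) atTop (𝓝 1)

/-- The space `[-∞, ∞]^h \ {0}`. -/
abbrev Punctured (h : ℕ) : Type := {y : Fin h → EReal // y ≠ 0}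

/-- Vague convergence of a sequence of measures. -/
def VagueTendsto {S : Type*} [TopologicalSpace S] [MeasurableSpace S] (μs : ℕ → Measure S)
    (μ : Measure S) : Prop :=
  ∀ g : S → ℝ, Continuous g → HasCompactSupport g →
    Tendsto (fun n => ∫ y, g y ∂(μs n)) atTop (𝓝 (∫ y, g y ∂μ))

/-- The restriction to `[-∞, ∞]^h \ {0}` of the law of the rescaled random vector `V / s`. -/
def rescaledLaw {Ω : Type*} [MeasurableSpace Ω] (P : Measure Ω) {h : ℕ} (V : Ω → Fin h → ℝ)
    (s : ℝ) : Measure (Punctured h) :=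
  (P.map (fun ω i => ((V ω i / s : ℝ) : EReal))).comap Subtype.val

/-- The lagged vector `(X_1, …, X_h)`. -/
def lagged {Ω : Type*} (X : ℤ → Ω → ℝ) (h : ℕ) (ω : Ω) (i : Fin h) : ℝ :=
  X ((i : ℤ) + 1) ω

/-- `μ` can be the limit measure of a regularly varying vector with index `α`: it is a non-null
Radon measure on `[-∞, ∞]^h \ {0}`, it is homogeneous, `μ(tA) = t ^ (-α) μ(A)`, and it does not
charge points with infinite components. -/
structure IsTailMeasure {h : ℕ} (α : ℝ) (μ : Measure (Punctured h)) : Prop where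
  ne_zero : μ ≠ 0
  radon : ∀ K : Set (Punctured h), IsCompact K → μ K < ∞
  homogeneous : ∀ t : ℝ, 0 < t → ∀ A : Set (Punctured h), MeasurableSet A →
    μ {y | ∃ z ∈ A, ∀ i, y.1 i = (t : EReal) * z.1 i} = ENNReal.ofReal (t ^ (-α)) * μ A
  infinite_null : μ {y | ∃ i, y.1 i = ⊤ ∨ y.1 i = ⊥} = 0

/-- The finite-dimensional distributions of `X` are regularly varying with index `α`, and `μ h`,
`h ≥ 1`, are the limit measures: `n P((X_1, …, X_h) / a_n ∈ ·) → μ h` vaguely, with a normalization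
`P(|X_0| > a_n) ∼ 1 / n` that does not depend on the dimension `h`. -/
structure IsRegularlyVarying {Ω : Type*} [MeasurableSpace Ω] (P : Measure Ω) (X : ℤ → Ω → ℝ)
    (α : ℝ) (μ : ∀ h : ℕ, Measure (Punctured h)) : Prop where
  exists_normalizing : ∃ a, IsNormalizing P (X 0) a
  isTailMeasure : ∀ h, 1 ≤ h → IsTailMeasure α (μ h)
  vague : ∀ a, IsNormalizing P (X 0) a → ∀ h, 1 ≤ h →
    VagueTendsto (fun n : ℕ => (n : ℝ≥0∞) • rescaledLaw P (lagged X h) (a n)) (μ h)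

/-- `θ ∈ [0, 1]` is the extremal index of `X`: for each `τ > 0` there are levels `u_n` with
`n P(X > u_n) → τ` and `P(max (X_1, …, X_n) ≤ u_n) → exp (-θ τ)`. -/
def HasExtremalIndex {Ω : Type*} [MeasurableSpace Ω] (P : Measure Ω) (X : ℤ → Ω → ℝ)
    (θ : ℝ) : Prop :=
  0 ≤ θ ∧ θ ≤ 1 ∧ ∀ τ : ℝ, 0 < τ → ∃ u : ℕ → ℝ,
    Tendsto (fun n : ℕ => (n : ℝ) * P.real {ω | u n < X 0 ω}) atTop (𝓝 τ) ∧
    Tendsto (fun n : ℕ => P.real {ω | ∀ i : Fin n, lagged X n ω i ≤ u n}) atTop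
      (𝓝 (Real.exp (-(θ * τ))))

/-- `γ` is the value `γ_{AB}(h)` of the extremogram:
`n cov(1{X_0 / a_n ∈ A}, 1{X_h / a_n ∈ B}) → γ` if `P(|X_0| > a_n) ∼ 1 / n`. -/
def HasExtremogram {Ω : Type*} [MeasurableSpace Ω] (P : Measure Ω) (X : ℤ → Ω → ℝ)
    (A B : Set ℝ) (h : ℕ) (γ : ℝ) : Prop :=
  ∀ a : ℕ → ℝ, IsNormalizing P (X 0) a →
    Tendsto (fun n : ℕ => (n : ℝ) *
      cov[Set.indicator {ω | X 0 ω / a n ∈ A} (fun _ => (1 : ℝ)),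
        Set.indicator {ω | X h ω / a n ∈ B} (fun _ => (1 : ℝ)); P]) atTop (𝓝 γ)

/-- `r` is the upper tail dependence coefficient `ρ(h)`: `P(X_h > x | X_0 > x) → r` as `x → ∞`. -/
def HasTailDependence {Ω : Type*} [MeasurableSpace Ω] (P : Measure Ω) (X : ℤ → Ω → ℝ)
    (h : ℕ) (r : ℝ) : Prop :=
  Tendsto (fun x : ℝ => (ProbabilityTheory.cond P {ω | x < X 0 ω}).real {ω | x < X h ω})
    atTop (𝓝 r)

/-- The σ-field generated by `X_t`, `t ∈ C`. -/
abbrev sigmaField {Ω : Type*} (X : ℤ → Ω → ℝ) (C : Set ℤ) : MeasurableSpace Ω :=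
  ⨆ t ∈ C, MeasurableSpace.comap (X t) (borel ℝ)

/-- The `α`-mixing coefficient `sup |P(A ∩ B) - P(A) P(B)|` over `A ∈ σ(S₁)`, `B ∈ σ(S₂)`. -/
def mixingCoeff {Ω : Type*} [MeasurableSpace Ω] (P : Measure Ω) (X : ℤ → Ω → ℝ)
    (S₁ S₂ : Set ℤ) : ℝ≥0∞ :=
  ⨆ (A : Set Ω) (_ : MeasurableSet[sigmaField X S₁] A)
    (B : Set Ω) (_ : MeasurableSet[sigmaField X S₂] B),
    ENNReal.ofReal |P.real (A ∩ B) - P.real A * P.real B|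

/-- The mixing rate function `α_h = α({…, -1, 0}, {h, h + 1, …})`. -/
def mixingRate {Ω : Type*} [MeasurableSpace Ω] (P : Measure Ω) (X : ℤ → Ω → ℝ) (h : ℕ) : ℝ≥0∞ :=
  mixingCoeff P X (Iic 0) (Ici (h : ℤ))

end

end MaxStable

set_option linter.unusedSectionVars false

/-! Everything is read off the void probabilities of the Poisson points. Up to a null set, X_t ≤ x
with x > 0 means that no point (Γ_i, Y_i) lies in `exceedance α (f t) x`, the region 0 < g <
(f_t(y)/x)^α under a graph. A finite union of such regions is the region under the maximum, so
P(X_{t_i} ≤ x_i for all i) = exp(-V(x)) with V(x) = ∫ max_i (f_{t_i}/x_i)^α dν (`real_forall_le`). V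
is homogeneous of degree -α, stationarity makes it shift invariant, and min = sum - max turns it
into the integrals ∫ f_s^α ∧ f_t^α dν. Write C = ∫ f_0^α dν.

Extremogram, tail dependence, extremal index: since 1 - e^{-v} ~ v as v → 0
(`tendsto_mul_one_sub_exp_iff`), tail probabilities behave like the exponents. The law of the
maximum is exactly exp(-θ_n v_n), where θ_n is the normalized quotient of part (2) and v_n = n
u_n^{-α} C tends to τ if and only if n P(X_0 > u_n) does.

Regular variation: the limit measure is the image of C⁻¹ Leb × ν under (g, y) ↦ (g^{-1/α} f_i(y))_i.
Complements of boxes determine the distribution functions of the restrictions away from the origin,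
hence weak convergence there; compactly supported test functions vanish near the origin.

Mixing, with c = 1: events determined by finitely many thresholds depend only on which cells of a
finite partition of (0,∞) × E are occupied, and these occupations are independent Bernoulli
variables. A covariance inequality (`abs_bernoulli_covariance_le`) bounds the dependence by the
cells that are influential for both events. A cell is influential at time t only if, for some
threshold it exceeds, the rest of that exceedance region is empty; this void probability is at most
exp(-C g / f_t(y)^α) for every (g, y) in the cell. Summing over cells and integrating over g gives ∫
f_s^α ∧ f_t^α dν / C for each pair of times (`abs_real_inter_sub_le`). General events are
approximated from a generating ring. -/

namespace MaxStable

/-! ### Void probabilities and exceedance regions of the Poisson points -/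

section Points

variable {E Ω : Type*} [MeasurableSpace E] [MeasurableSpace Ω] {ν : Measure E} {P : Measure Ω}
  {Γ : ℕ → Ω → ℝ} {Y : ℕ → Ω → E}

theorem pointMeasure_apply (ω : Ω) {A : Set (ℝ × E)} (hA : MeasurableSet A) :
    pointMeasure Γ Y ω A = ∑' i, A.indicator 1 (Γ i ω, Y i ω) := by
  simp [pointMeasure, Measure.sum_apply _ hA, Measure.dirac_apply' _ hA]

theorem pointMeasure_eq_zero_iff (ω : Ω) {A : Set (ℝ × E)} (hA : MeasurableSet A) :
    pointMeasure Γ Y ω A = 0 ↔ ∀ i, (Γ i ω, Y i ω) ∉ A := by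
  simp [pointMeasure_apply ω hA, ENNReal.tsum_eq_zero]

theorem IsPoissonPoints.measurable_pair (h : IsPoissonPoints P ν Γ Y) (i : ℕ) :
    Measurable fun ω => (Γ i ω, Y i ω) :=
  (h.measurable_fst i).prodMk (h.measurable_snd i)

theorem IsPoissonPoints.measurable_count (h : IsPoissonPoints P ν Γ Y) {A : Set (ℝ × E)}
    (hA : MeasurableSet A) : Measurable fun ω => pointMeasure Γ Y ω A := by
  simp_rw [pointMeasure_apply _ hA]
  refine Measurable.tsum fun i => ?_
  exact (measurable_one.indicator hA).comp (h.measurable_pair i)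

theorem IsPoissonPoints.measure_count_eq_zero (h : IsPoissonPoints P ν Γ Y) {A : Set (ℝ × E)}
    (hA : MeasurableSet A) (hfin : intensity ν A ≠ ∞) :
    P {ω | pointMeasure Γ Y ω A = 0} = ENNReal.ofReal (Real.exp (-(intensity ν A).toReal)) := by
  have h1 := congrArg (fun μ : Measure ℝ≥0∞ => μ {0}) (h.poisson_count A hA hfin)
  rw [Measure.map_apply (h.measurable_count hA) (measurableSet_singleton 0),
    Measure.map_apply (by fun_prop) (measurableSet_singleton 0)] at h1
  have h2 : ((fun k : ℕ => (k : ℝ≥0∞)) ⁻¹' {0}) = {0} := by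
    ext k; simp
  rw [h2, poissonMeasure_singleton] at h1
  refine Eq.trans rfl (h1.trans ?_)
  simp [ENNReal.toReal]

/-- The void probabilities of a Poisson random measure. -/
theorem IsPoissonPoints.real_avoid (h : IsPoissonPoints P ν Γ Y) {A : Set (ℝ × E)}
    (hA : MeasurableSet A) (hfin : intensity ν A ≠ ∞) :
    P.real {ω | ∀ i, (Γ i ω, Y i ω) ∉ A} = Real.exp (-(intensity ν A).toReal) := by
  simp_rw [← pointMeasure_eq_zero_iff _ hA]
  rw [measureReal_def, h.measure_count_eq_zero hA hfin, ENNReal.toReal_ofReal (Real.exp_nonneg _)]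

/-- The points `(g, y)` of `(0, ∞) × E` with `g ^ (-1/α) φ y > x`. -/
def exceedance (α : ℝ) (φ : E → ℝ) (x : ℝ) : Set (ℝ × E) :=
  {p | 0 < p.1 ∧ x < p.1 ^ (-(1 / α)) * φ p.2}

theorem measurableSet_exceedance (α : ℝ) {φ : E → ℝ} (hφ : Measurable φ) (x : ℝ) :
    MeasurableSet (exceedance α φ x) := by
  refine (measurableSet_lt measurable_const measurable_fst).inter
    (measurableSet_lt (f := fun _ => x) (g := fun p : ℝ × E => p.1 ^ (-(1 / α)) * φ p.2)
      measurable_const ?_)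
  exact (measurable_fst.pow_const _).mul (hφ.comp measurable_snd)

/-- Solving for g is what makes exceedance regions into regions under graphs, whose intensity is an
integral over E. -/
theorem lt_rpow_mul_iff {α g z x : ℝ} (hα : 0 < α) (hx : 0 < x) (hg : 0 < g) (hz : 0 ≤ z) :
    x < g ^ (-(1 / α)) * z ↔ g < (z / x) ^ α := by
  rw [Real.rpow_neg hg.le, one_div, ← Real.rpow_inv_lt_iff_of_pos hg.le (by positivity) hα,
    inv_mul_eq_div, lt_div_iff₀ (by positivity), lt_div_iff₀ hx, mul_comm]

theorem mem_exceedance_iff {α x : ℝ} (hα : 0 < α) (hx : 0 < x) {φ : E → ℝ} (hφ : ∀ y, 0 ≤ φ y)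
    (p : ℝ × E) : p ∈ exceedance α φ x ↔ 0 < p.1 ∧ p.1 < (φ p.2 / x) ^ α :=
  and_congr_right fun hg => lt_rpow_mul_iff hα hx hg (hφ _)

/-- Regions under graphs: being below one of finitely many functions is being below their maximum.
For empty `ι` the real supremum is 0 and both sides are empty. -/
theorem iUnion_exceedance {ι : Type*} [Finite ι] {α : ℝ} (hα : 0 < α) {x : ι → ℝ}
    (hx : ∀ i, 0 < x i) {φ : ι → E → ℝ} (hφ : ∀ i y, 0 ≤ φ i y) :
    ⋃ i, exceedance α (φ i) (x i) = {p | 0 < p.1 ∧ p.1 < ⨆ i, (φ i p.2 / x i) ^ α} := by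
  ext p
  simp only [mem_iUnion, mem_exceedance_iff hα (hx _) (hφ _), mem_ofPred_eq]
  rcases isEmpty_or_nonempty ι with hι | hι
  · simp [Real.iSup_of_isEmpty]
    exact fun h => h.le
  · rw [exists_and_left, lt_ciSup_iff (Finite.bddAbove_range _)]

theorem intensity_lt [SigmaFinite ν] {k : E → ℝ} (hk : Measurable k) :
    intensity ν {p | 0 < p.1 ∧ p.1 < k p.2} = ∫⁻ y, ENNReal.ofReal (k y) ∂ν := by
  have hm : MeasurableSet {p : ℝ × E | 0 < p.1 ∧ p.1 < k p.2} :=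
    (measurableSet_lt measurable_const measurable_fst).inter
      (measurableSet_lt measurable_fst (hk.comp measurable_snd))
  rw [intensity, Measure.prod_apply_symm hm]
  refine lintegral_congr fun y => ?_
  have : (fun x => (x, y)) ⁻¹' {p : ℝ × E | 0 < p.1 ∧ p.1 < k p.2} = Ioo 0 (k y) := by
    ext; simp
  rw [this, Measure.restrict_apply measurableSet_Ioo,
    inter_eq_left.2 Ioo_subset_Ioi_self, Real.volume_Ioo, sub_zero]

end Points

/-! ### The exponent of a finite family -/

/-- The exponent `∫ max_i (φ_i / x_i) ^ α dν` of a finite family of max-stable integrals. -/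
noncomputable def tailExponent {E ι : Type*} [MeasurableSpace E] (ν : Measure E) (α : ℝ)
    (φ : ι → E → ℝ) (x : ι → ℝ) : ℝ :=
  ∫ y, ⨆ i, (φ i y / x i) ^ α ∂ν

section Exponent

variable {E ι : Type*} [MeasurableSpace E] [Finite ι] {ν : Measure E} {α : ℝ} {φ : ι → E → ℝ}
  {x : ι → ℝ}

theorem iSup_rpow_nonneg (hφ : ∀ i y, 0 ≤ φ i y) (hx : ∀ i, 0 < x i) (y : E) :
    0 ≤ ⨆ i, (φ i y / x i) ^ α :=
  Real.iSup_nonneg fun i => Real.rpow_nonneg (div_nonneg (hφ i y) (hx i).le) _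

theorem tailExponent_nonneg (hφ : ∀ i y, 0 ≤ φ i y) (hx : ∀ i, 0 < x i) :
    0 ≤ tailExponent ν α φ x :=
  integral_nonneg fun y => iSup_rpow_nonneg hφ hx y

theorem integrable_iSup_of_nonneg {g : ι → E → ℝ} (hg : ∀ i, Integrable (g i) ν)
    (hm : ∀ i, Measurable (g i)) (h0 : ∀ i y, 0 ≤ g i y) :
    Integrable (fun y => ⨆ i, g i y) ν := by
  cases nonempty_fintype ι
  refine (integrable_finsetSum Finset.univ fun i _ => hg i).mono'
    (Measurable.iSup hm).aestronglyMeasurable (Eventually.of_forall fun y => ?_)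
  rw [Real.norm_of_nonneg (Real.iSup_nonneg fun i => h0 i y)]
  refine Real.iSup_le (fun i => ?_) (Finset.sum_nonneg fun i _ => h0 i y)
  exact Finset.single_le_sum (f := fun i => g i y) (fun i _ => h0 i y) (Finset.mem_univ i)

theorem integrable_rpow_of_memLp {f : E → ℝ} (hα : 0 < α) (hf : ∀ y, 0 ≤ f y)
    (h : MemLp f (ENNReal.ofReal α) ν) : Integrable (fun y => f y ^ α) ν := by
  have := h.integrable_norm_rpow (by simpa using hα) ENNReal.ofReal_ne_top
  rw [ENNReal.toReal_ofReal hα.le] at this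
  refine this.congr (Eventually.of_forall fun y => ?_)
  simp [abs_of_nonneg (hf y)]

theorem integrable_iSup_rpow (hα : 0 < α) (hφm : ∀ i, Measurable (φ i))
    (hφ : ∀ i y, 0 ≤ φ i y) (hL : ∀ i, MemLp (φ i) (ENNReal.ofReal α) ν) (hx : ∀ i, 0 < x i) :
    Integrable (fun y => ⨆ i, (φ i y / x i) ^ α) ν := by
  refine integrable_iSup_of_nonneg (fun i => ?_) (fun i => ((hφm i).div_const _).pow_const _)
    (fun i y => Real.rpow_nonneg (div_nonneg (hφ i y) (hx i).le) _)
  simp_rw [fun y => Real.div_rpow (hφ i y) (hx i).le α]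
  exact (integrable_rpow_of_memLp hα (hφ i) (hL i)).div_const _

theorem tailExponent_smul {s : ℝ} (hs : 0 < s) (hφ : ∀ i y, 0 ≤ φ i y) (hx : ∀ i, 0 < x i) :
    tailExponent ν α φ (fun i => s * x i) = s ^ (-α) * tailExponent ν α φ x := by
  rw [tailExponent, tailExponent, ← integral_const_mul]
  congr 1 with y
  rw [Real.mul_iSup_of_nonneg (by positivity)]
  congr 1 with i
  have := hφ i y
  have := hx i
  rw [Real.div_rpow (by positivity) (by positivity), Real.div_rpow (by positivity) (by positivity),
    Real.mul_rpow hs.le (by positivity), Real.rpow_neg hs.le]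
  field_simp

theorem intensity_iUnion_exceedance [SigmaFinite ν] (hα : 0 < α) (hφm : ∀ i, Measurable (φ i))
    (hφ : ∀ i y, 0 ≤ φ i y) (hL : ∀ i, MemLp (φ i) (ENNReal.ofReal α) ν) (hx : ∀ i, 0 < x i) :
    intensity ν (⋃ i, exceedance α (φ i) (x i)) = ENNReal.ofReal (tailExponent ν α φ x) := by
  rw [iUnion_exceedance hα hx hφ,
    intensity_lt (k := fun y => ⨆ i, (φ i y / x i) ^ α), tailExponent, ofReal_integral_eq_lintegral_ofReal]
  · exact integrable_iSup_rpow hα hφm hφ hL hx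
  · exact Eventually.of_forall fun y => iSup_rpow_nonneg hφ hx y
  · exact Measurable.iSup fun i => ((hφm i).div_const _).pow_const _

end Exponent

/-! ### Finite-dimensional distributions and stationarity of the exponents -/

/-- The data of the max-stable process `X_t = sup_i Γ_i ^ (-1/α) f_t(Y_i)`. -/
structure IsMaxStableProcess {E Ω : Type*} [MeasurableSpace E] [MeasurableSpace Ω]
    (ν : Measure E) (P : Measure Ω) (α : ℝ) (Γ : ℕ → Ω → ℝ) (Y : ℕ → Ω → E) (f : ℤ → E → ℝ)
    (X : ℤ → Ω → ℝ) : Prop where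
  index_pos : 0 < α
  points : IsPoissonPoints P ν Γ Y
  measurable : ∀ t, Measurable (f t)
  nonneg : ∀ t y, 0 ≤ f t y
  memLp : ∀ t, MemLp (f t) (ENNReal.ofReal α) ν
  eq_integral : ∀ t ω, X t ω = maxStableIntegral α Γ Y (f t) ω

namespace IsMaxStableProcess

variable {E Ω : Type*} [MeasurableSpace E] [MeasurableSpace Ω] {ν : Measure E} [SigmaFinite ν]
  {P : Measure Ω} [IsProbabilityMeasure P] {α : ℝ} {Γ : ℕ → Ω → ℝ} {Y : ℕ → Ω → E}
  {f : ℤ → E → ℝ} {X : ℤ → Ω → ℝ}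

theorem measurable_term (hX : IsMaxStableProcess ν P α Γ Y f X) (t : ℤ) (i : ℕ) :
    Measurable fun ω => Γ i ω ^ (-(1 / α)) * f t (Y i ω) :=
  ((hX.points.measurable_fst i).pow_const _).mul
    ((hX.measurable t).comp (hX.points.measurable_snd i))

theorem measurable_process (hX : IsMaxStableProcess ν P α Γ Y f X) (t : ℤ) :
    Measurable (X t) := by
  have : X t = fun ω => ⨆ i, Γ i ω ^ (-(1 / α)) * f t (Y i ω) := funext (hX.eq_integral t)
  rw [this]
  exact Measurable.iSup fun i => hX.measurable_term t i

theorem term_nonneg (hX : IsMaxStableProcess ν P α Γ Y f X) (t : ℤ) (i : ℕ) (ω : Ω) :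
    0 ≤ Γ i ω ^ (-(1 / α)) * f t (Y i ω) :=
  mul_nonneg (Real.rpow_nonneg (hX.points.pos i ω).le _) (hX.nonneg t _)

theorem process_nonneg (hX : IsMaxStableProcess ν P α Γ Y f X) (t : ℤ) (ω : Ω) : 0 ≤ X t ω := by
  rw [hX.eq_integral]
  exact Real.iSup_nonneg fun i => hX.term_nonneg t i ω

theorem notMem_exceedance_iff (hX : IsMaxStableProcess ν P α Γ Y f X) (t : ℤ) (i : ℕ) (ω : Ω)
    (x : ℝ) : (Γ i ω, Y i ω) ∉ exceedance α (f t) x ↔ Γ i ω ^ (-(1 / α)) * f t (Y i ω) ≤ x := by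
  simp [exceedance, hX.points.pos i ω]

theorem intensity_exceedance (hX : IsMaxStableProcess ν P α Γ Y f X) (t : ℤ) {x : ℝ} (hx : 0 < x) :
    intensity ν (exceedance α (f t) x)
      = ENNReal.ofReal (x ^ (-α) * ∫ y, f t y ^ α ∂ν) := by
  have h := intensity_iUnion_exceedance (ι := Unit) (ν := ν) (φ := fun _ => f t) (x := fun _ => x)
    hX.index_pos (fun _ => hX.measurable t) (fun _ => hX.nonneg t) (fun _ => hX.memLp t)
    (fun _ => hx)
  rw [iUnion_const] at h
  rw [h, tailExponent, ← integral_const_mul]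
  congr 2 with y
  rw [ciSup_const, Real.div_rpow (hX.nonneg t y) hx.le, Real.rpow_neg hx.le, inv_mul_eq_div]

/-- The supremum defining `X_t` is almost surely finite. -/
theorem ae_bddAbove (hX : IsMaxStableProcess ν P α Γ Y f X) (t : ℤ) :
    ∀ᵐ ω ∂P, BddAbove (range fun i => Γ i ω ^ (-(1 / α)) * f t (Y i ω)) := by
  set C := ∫ y, f t y ^ α ∂ν
  -- An unbounded family has a point above every level n + 1, so the exceptional event has
  -- probability at most that of a nonvoid exceedance region; this tends to 0 as n grows.
  have key : ∀ n : ℕ, 1 - Real.exp (-(((n : ℝ) + 1) ^ (-α) * C)) ≥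
      P.real {ω | BddAbove (range fun i => Γ i ω ^ (-(1 / α)) * f t (Y i ω))}ᶜ := by
    intro n
    have hn : (0 : ℝ) < n + 1 := by positivity
    have hC : 0 ≤ C := integral_nonneg fun y => Real.rpow_nonneg (hX.nonneg t y) _
    have hm := measurableSet_exceedance α (hX.measurable t) (n + 1)
    have h1 := hX.points.real_avoid hm (by rw [hX.intensity_exceedance t hn]; simp)
    rw [hX.intensity_exceedance t hn, ENNReal.toReal_ofReal (by positivity)] at h1
    rw [← h1, ← probReal_compl_eq_one_sub]
    · refine measureReal_mono fun ω hω => ?_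
      contrapose! hω
      simp only [mem_compl_iff, not_not, mem_ofPred_eq, hX.notMem_exceedance_iff] at hω ⊢
      exact ⟨n + 1, by rintro _ ⟨i, rfl⟩; exact hω i⟩
    · simp only [ofPred_forall]
      exact MeasurableSet.iInter fun i => (hX.points.measurable_pair i hm).compl
  have hlim : Tendsto (fun n : ℕ => 1 - Real.exp (-(((n : ℝ) + 1) ^ (-α) * C))) atTop (𝓝 0) := by
    have h1 : Tendsto (fun n : ℕ => ((n : ℝ) + 1) ^ (-α)) atTop (𝓝 0) :=
      (tendsto_rpow_neg_atTop hX.index_pos).comp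
        (tendsto_atTop_add_const_right _ _ tendsto_natCast_atTop_atTop)
    have := ((Real.continuous_exp.tendsto _).comp (h1.mul_const C).neg).const_sub 1
    simpa using this
  have h0 := ge_of_tendsto hlim (Eventually.of_forall key)
  rw [ae_iff]
  exact (measureReal_eq_zero_iff).1 (le_antisymm h0 measureReal_nonneg)

/-- Only almost sure: the real supremum of an unbounded family is 0 by convention, which would break
the equivalence. The null set is chosen before the level x. -/
theorem ae_le_iff (hX : IsMaxStableProcess ν P α Γ Y f X) (t : ℤ) :
    ∀ᵐ ω ∂P, ∀ x, X t ω ≤ x ↔ ∀ i, (Γ i ω, Y i ω) ∉ exceedance α (f t) x := by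
  filter_upwards [hX.ae_bddAbove t] with ω hω x
  simp_rw [hX.notMem_exceedance_iff, hX.eq_integral]
  exact ciSup_le_iff hω

/-- The finite-dimensional distribution functions of a max-stable process. -/
theorem real_forall_le (hX : IsMaxStableProcess ν P α Γ Y f X) {ι : Type*} [Finite ι] (t : ι → ℤ)
    {x : ι → ℝ} (hx : ∀ i, 0 < x i) :
    P.real {ω | ∀ i, X (t i) ω ≤ x i}
      = Real.exp (-tailExponent ν α (fun i => f (t i)) x) := by
  have hint := intensity_iUnion_exceedance (ν := ν) (φ := fun i => f (t i)) (x := x) hX.index_pos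
    (fun i => hX.measurable _) (fun i => hX.nonneg _) (fun i => hX.memLp _) hx
  have hm : MeasurableSet (⋃ i, exceedance α (f (t i)) (x i)) :=
    MeasurableSet.iUnion fun i => measurableSet_exceedance α (hX.measurable _) _
  have := hX.points.real_avoid hm (by rw [hint]; simp)
  rw [hint, ENNReal.toReal_ofReal (tailExponent_nonneg (fun i => hX.nonneg _) hx)] at this
  rw [← this]
  refine measureReal_congr ?_
  have hall : ∀ᵐ ω ∂P, ∀ i, ∀ x, X (t i) ω ≤ x ↔ ∀ j, (Γ j ω, Y j ω) ∉ exceedance α (f (t i)) x :=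
    ae_all_iff.2 fun i => hX.ae_le_iff (t i)
  filter_upwards [hall] with ω hω
  refine propext ?_
  change (∀ i, X (t i) ω ≤ x i) ↔ ∀ i, (Γ i ω, Y i ω) ∉ ⋃ i, exceedance α (f (t i)) (x i)
  simp only [hω, mem_iUnion, not_exists]
  exact forall_comm

theorem real_le (hX : IsMaxStableProcess ν P α Γ Y f X) (t : ℤ) {x : ℝ} (hx : 0 < x) :
    P.real {ω | X t ω ≤ x} = Real.exp (-(x ^ (-α) * ∫ y, f t y ^ α ∂ν)) := by
  have h := hX.real_forall_le (ι := Unit) (fun _ => t) (x := fun _ => x) (fun _ => hx)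
  simp only [forall_const, tailExponent, ciSup_const] at h
  rw [h, ← integral_const_mul]
  congr 3 with y
  rw [Real.div_rpow (hX.nonneg t y) hx.le, Real.rpow_neg hx.le, inv_mul_eq_div]

theorem measurableSet_le (hX : IsMaxStableProcess ν P α Γ Y f X) {ι : Type*} [Countable ι]
    (t : ι → ℤ) (x : ι → ℝ) : MeasurableSet {ω | ∀ i, X (t i) ω ≤ x i} := by
  simp only [ofPred_forall]
  exact MeasurableSet.iInter fun i =>
    _root_.measurableSet_le (hX.measurable_process _) measurable_const

theorem real_exists_lt (hX : IsMaxStableProcess ν P α Γ Y f X) {ι : Type*} [Finite ι] (t : ι → ℤ)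
    {x : ι → ℝ} (hx : ∀ i, 0 < x i) :
    P.real {ω | ∃ i, x i < X (t i) ω}
      = 1 - Real.exp (-tailExponent ν α (fun i => f (t i)) x) := by
  rw [← hX.real_forall_le t hx, ← probReal_compl_eq_one_sub (hX.measurableSet_le t x)]
  congr 1
  ext ω
  simp

theorem real_lt (hX : IsMaxStableProcess ν P α Γ Y f X) (t : ℤ) {x : ℝ} (hx : 0 < x) :
    P.real {ω | x < X t ω} = 1 - Real.exp (-(x ^ (-α) * ∫ y, f t y ^ α ∂ν)) := by
  rw [← hX.real_le t hx, ← probReal_compl_eq_one_sub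
    (_root_.measurableSet_le (hX.measurable_process _) measurable_const)]
  congr 1
  ext ω
  simp

/-- A stationary max-stable process has stationary exponents. -/
theorem tailExponent_shift (hX : IsMaxStableProcess ν P α Γ Y f X) (hs : IsStrictlyStationary P X)
    {ι : Type*} [Finite ι] (t : ι → ℤ) (k : ℤ) {x : ι → ℝ} (hx : ∀ i, 0 < x i) :
    tailExponent ν α (fun i => f (t i + k)) x = tailExponent ν α (fun i => f (t i)) x := by
  have h := (hs k).measure_mem_eq (s := {z : ℤ → ℝ | ∀ i, z (t i) ≤ x i}) (by
    simp only [ofPred_forall]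
    exact MeasurableSet.iInter fun i =>
      _root_.measurableSet_le (measurable_pi_apply _) measurable_const)
  have h' : P.real {ω | ∀ i, X (t i + k) ω ≤ x i} = P.real {ω | ∀ i, X (t i) ω ≤ x i} :=
    congrArg ENNReal.toReal h
  rw [hX.real_forall_le t hx, hX.real_forall_le (fun i => t i + k) hx] at h'
  simpa using h'

theorem integral_rpow_eq (hX : IsMaxStableProcess ν P α Γ Y f X) (hs : IsStrictlyStationary P X)
    (t : ℤ) : ∫ y, f t y ^ α ∂ν = ∫ y, f 0 y ^ α ∂ν := by
  simpa [tailExponent] using hX.tailExponent_shift hs (fun _ : Unit => 0) t (x := fun _ => 1)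
    (by simp)

theorem integrable_rpow (hX : IsMaxStableProcess ν P α Γ Y f X) (t : ℤ) :
    Integrable (fun y => f t y ^ α) ν :=
  integrable_rpow_of_memLp hX.index_pos (hX.nonneg t) (hX.memLp t)

theorem integrable_iSup (hX : IsMaxStableProcess ν P α Γ Y f X) {ι : Type*} [Finite ι] (t : ι → ℤ)
    {x : ι → ℝ} (hx : ∀ i, 0 < x i) : Integrable (fun y => ⨆ i, (f (t i) y / x i) ^ α) ν :=
  integrable_iSup_rpow hX.index_pos (fun _ => hX.measurable _) (fun _ => hX.nonneg _)
    (fun _ => hX.memLp _) hx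

/-- Pointwise max = sum - min, integrated; this is inclusion-exclusion for two exceedance regions.
-/
theorem tailExponent_pair (hX : IsMaxStableProcess ν P α Γ Y f X) (s t : ℤ) {a b : ℝ}
    (ha : 0 < a) (hb : 0 < b) :
    tailExponent ν α (fun i => f ((![s, t] : Fin 2 → ℤ) i)) ![a, b] =
      a ^ (-α) * ∫ y, f s y ^ α ∂ν + b ^ (-α) * ∫ y, f t y ^ α ∂ν
        - ∫ y, min ((f s y / a) ^ α) ((f t y / b) ^ α) ∂ν := by
  have e : ∀ (t : ℤ) {a : ℝ} (_ : 0 < a) (y : E), (f t y / a) ^ α = a ^ (-α) * f t y ^ α := by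
    intro t a ha y
    rw [Real.div_rpow (hX.nonneg t y) ha.le, Real.rpow_neg ha.le, inv_mul_eq_div]
  have i1 : Integrable (fun y => (f s y / a) ^ α) ν := by
    simp_rw [e s ha]; exact (hX.integrable_rpow s).const_mul _
  have i2 : Integrable (fun y => (f t y / b) ^ α) ν := by
    simp_rw [e t hb]; exact (hX.integrable_rpow t).const_mul _
  rw [← integral_const_mul, ← integral_const_mul]
  simp_rw [← e s ha, ← e t hb]
  have i3 : Integrable (fun y => min ((f s y / a) ^ α) ((f t y / b) ^ α)) ν := i1.inf i2
  rw [← integral_add i1 i2, ← integral_sub (by exact i1.add i2) i3, tailExponent]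
  congr 1 with y
  rw [← max_add_min ((f s y / a) ^ α) ((f t y / b) ^ α), add_sub_cancel_right]
  refine le_antisymm (ciSup_le fun i => ?_) (max_le ?_ ?_)
  · fin_cases i <;> simp
  · exact le_ciSup_of_le (Finite.bddAbove_range _) 0 le_rfl
  · exact le_ciSup_of_le (Finite.bddAbove_range _) 1 le_rfl

/-- Stationarity speaks about distribution functions, hence about maxima; it passes to the minimum
because the marginal integrals are shift invariant too. -/
theorem integral_min_shift (hX : IsMaxStableProcess ν P α Γ Y f X) (hs : IsStrictlyStationary P X)
    (s t : ℤ) : ∫ y, min (f s y ^ α) (f t y ^ α) ∂ν = ∫ y, min (f 0 y ^ α) (f (t - s) y ^ α) ∂ν := by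
  have h1 := hX.tailExponent_pair s t one_pos one_pos
  have h2 := hX.tailExponent_pair 0 (t - s) one_pos one_pos
  have h3 := hX.tailExponent_shift hs (![0, t - s] : Fin 2 → ℤ) s (x := ![1, 1])
    (by intro i; fin_cases i <;> simp)
  have h4 : (fun i => f ((![0, t - s] : Fin 2 → ℤ) i + s))
      = fun i => f ((![s, t] : Fin 2 → ℤ) i) := by
    ext i; fin_cases i <;> simp
  rw [h4, h1, h2] at h3
  simp only [Real.one_rpow, one_mul, div_one, hX.integral_rpow_eq hs s, hX.integral_rpow_eq hs t,
    hX.integral_rpow_eq hs (t - s)] at h3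
  linarith

end IsMaxStableProcess

/-! ### Tail asymptotics, extremogram and tail dependence -/

/-- As r → ∞, either limit forces v → 0, and v e^{-v} ≤ 1 - e^{-v} ≤ v for every real v, so the two
expressions differ by a factor between e^{-v} and 1. -/
theorem tendsto_mul_one_sub_exp_iff {ι : Type*} {l : Filter ι} {r v : ι → ℝ} {τ : ℝ}
    (hr : Tendsto r l atTop) :
    Tendsto (fun i => r i * (1 - Real.exp (-v i))) l (𝓝 τ) ↔
      Tendsto (fun i => r i * v i) l (𝓝 τ) := by
  have hr0 : ∀ᶠ i in l, 0 < r i := hr.eventually_gt_atTop 0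
  have small : ∀ {w : ι → ℝ}, Tendsto (fun i => r i * w i) l (𝓝 τ) → Tendsto w l (𝓝 0) := by
    intro w hw
    have := hw.mul hr.inv_tendsto_atTop
    rw [mul_zero] at this
    refine this.congr' ?_
    filter_upwards [hr0] with i hi
    simp only [Pi.inv_apply]
    field_simp
  have lower : ∀ v : ℝ, 1 - Real.exp (-v) ≤ v := fun v => by
    linarith [Real.add_one_le_exp (-v)]
  have upper : ∀ v : ℝ, v * Real.exp (-v) ≤ 1 - Real.exp (-v) := fun v => by
    have h := mul_le_mul_of_nonneg_right (Real.add_one_le_exp v) (Real.exp_nonneg (-v))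
    rw [← Real.exp_add, add_neg_cancel, Real.exp_zero] at h
    linarith
  constructor
  · intro h
    have he : Tendsto (fun i => Real.exp (-v i)) l (𝓝 1) := by
      simpa using (small h).const_sub 1
    have h2 := h.mul (he.inv₀ one_ne_zero)
    rw [inv_one, mul_one] at h2
    refine tendsto_of_tendsto_of_tendsto_of_le_of_le' h h2 ?_ ?_
    · filter_upwards [hr0] with i hi using mul_le_mul_of_nonneg_left (lower _) hi.le
    · filter_upwards [hr0] with i hi
      rw [mul_assoc]
      refine mul_le_mul_of_nonneg_left ?_ hi.le
      rw [← div_eq_mul_inv, le_div_iff₀ (Real.exp_pos _)]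
      exact upper _
  · intro h
    have he : Tendsto (fun i => Real.exp (-v i)) l (𝓝 1) := by
      have := (Real.continuous_exp.tendsto _).comp (small h).neg
      simpa [Function.comp_def] using this
    have h2 := h.mul he
    rw [mul_one] at h2
    refine tendsto_of_tendsto_of_tendsto_of_le_of_le' h2 h ?_ ?_
    · filter_upwards [hr0] with i hi
      rw [mul_assoc]
      exact mul_le_mul_of_nonneg_left (upper _) hi.le
    · filter_upwards [hr0] with i hi using mul_le_mul_of_nonneg_left (lower _) hi.le

namespace IsMaxStableProcess

variable {E Ω : Type*} [MeasurableSpace E] [MeasurableSpace Ω] {ν : Measure E} [SigmaFinite ν]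
  {P : Measure Ω} [IsProbabilityMeasure P] {α : ℝ} {Γ : ℕ → Ω → ℝ} {Y : ℕ → Ω → E}
  {f : ℤ → E → ℝ} {X : ℤ → Ω → ℝ}

/-- The rate r and the level u are kept general so that the same asymptotics serve n with a
normalizing sequence and x^α with a real level x. -/
theorem tendsto_real_exists_lt (hX : IsMaxStableProcess ν P α Γ Y f X) {κ : Type*} {l : Filter κ}
    {r u : κ → ℝ} {c : ℝ} (hr : Tendsto r l atTop) (hu : ∀ᶠ i in l, 0 < u i)
    (hc : Tendsto (fun i => r i * u i ^ (-α)) l (𝓝 c)) {ι : Type*} [Finite ι] (t : ι → ℤ)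
    {x : ι → ℝ} (hx : ∀ i, 0 < x i) :
    Tendsto (fun k => r k * P.real {ω | ∃ i, u k * x i < X (t i) ω}) l
      (𝓝 (c * tailExponent ν α (fun i => f (t i)) x)) := by
  have h := (tendsto_mul_one_sub_exp_iff
    (v := fun k => u k ^ (-α) * tailExponent ν α (fun i => f (t i)) x) hr).2
    (by simpa only [mul_assoc] using hc.mul_const (tailExponent ν α (fun i => f (t i)) x))
  refine h.congr' ?_
  filter_upwards [hu] with k hk
  rw [hX.real_exists_lt t fun i => mul_pos hk (hx i),
    tailExponent_smul hk (fun i => hX.nonneg _) hx]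

theorem tendsto_real_lt (hX : IsMaxStableProcess ν P α Γ Y f X) {κ : Type*} {l : Filter κ}
    {r u : κ → ℝ} {c : ℝ} (hr : Tendsto r l atTop) (hu : ∀ᶠ i in l, 0 < u i)
    (hc : Tendsto (fun i => r i * u i ^ (-α)) l (𝓝 c)) (t : ℤ) {x : ℝ} (hx : 0 < x) :
    Tendsto (fun k => r k * P.real {ω | u k * x < X t ω}) l
      (𝓝 (c * (x ^ (-α) * ∫ y, f t y ^ α ∂ν))) := by
  have h := (tendsto_mul_one_sub_exp_iff
    (v := fun k => u k ^ (-α) * (x ^ (-α) * ∫ y, f t y ^ α ∂ν)) hr).2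
    (by simpa only [mul_assoc] using hc.mul_const (x ^ (-α) * ∫ y, f t y ^ α ∂ν))
  refine h.congr' ?_
  filter_upwards [hu] with k hk
  rw [hX.real_lt t (mul_pos hk hx), Real.mul_rpow hk.le hx.le, mul_assoc]

/-- Inclusion-exclusion: the intersection is recovered from the two marginal tails and the union,
whose exponent is `tailExponent_pair`. -/
theorem tendsto_real_lt_and_lt (hX : IsMaxStableProcess ν P α Γ Y f X) {κ : Type*} {l : Filter κ}
    {r u : κ → ℝ} {c : ℝ} (hr : Tendsto r l atTop) (hu : ∀ᶠ i in l, 0 < u i)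
    (hc : Tendsto (fun i => r i * u i ^ (-α)) l (𝓝 c)) (s t : ℤ) {a b : ℝ} (ha : 0 < a)
    (hb : 0 < b) :
    Tendsto (fun k => r k * P.real ({ω | u k * a < X s ω} ∩ {ω | u k * b < X t ω})) l
      (𝓝 (c * ∫ y, min ((f s y / a) ^ α) ((f t y / b) ^ α) ∂ν)) := by
  have h1 := hX.tendsto_real_lt hr hu hc s ha
  have h2 := hX.tendsto_real_lt hr hu hc t hb
  have h3 := hX.tendsto_real_exists_lt hr hu hc (![s, t] : Fin 2 → ℤ) (x := ![a, b])
    (by intro i; fin_cases i <;> simpa)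
  rw [hX.tailExponent_pair s t ha hb] at h3
  have h4 := (h1.add h2).sub h3
  convert! h4 using 2 with k
  · have hm : MeasurableSet {ω | u k * b < X t ω} :=
      _root_.measurableSet_lt measurable_const (hX.measurable_process _)
    have e := measureReal_union_add_inter (μ := P) (s := {ω | u k * a < X s ω}) hm
    have e2 : {ω | ∃ i, u k * (![a, b] : Fin 2 → ℝ) i < X ((![s, t] : Fin 2 → ℤ) i) ω}
        = {ω | u k * a < X s ω} ∪ {ω | u k * b < X t ω} := by
      ext ω; simp [Fin.exists_fin_two]
    rw [e2]
    linear_combination (r k) * e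
  · ring

theorem isNormalizing_iff (hX : IsMaxStableProcess ν P α Γ Y f X) (a : ℕ → ℝ) :
    IsNormalizing P (X 0) a ↔ Tendsto a atTop atTop ∧
      Tendsto (fun n : ℕ => (n : ℝ) * (a n ^ (-α) * ∫ y, f 0 y ^ α ∂ν)) atTop (𝓝 1) := by
  refine and_congr_right fun ha => ?_
  rw [← tendsto_mul_one_sub_exp_iff (v := fun n => a n ^ (-α) * ∫ y, f 0 y ^ α ∂ν)
    tendsto_natCast_atTop_atTop]
  refine tendsto_congr' ?_
  filter_upwards [ha.eventually_gt_atTop 0] with n hn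
  simp_rw [abs_of_nonneg (hX.process_nonneg 0 _)]
  rw [hX.real_lt 0 hn]

theorem tendsto_of_isNormalizing (hX : IsMaxStableProcess ν P α Γ Y f X)
    (hC : 0 < ∫ y, f 0 y ^ α ∂ν) {a : ℕ → ℝ} (ha : IsNormalizing P (X 0) a) :
    Tendsto (fun n : ℕ => (n : ℝ) * a n ^ (-α)) atTop (𝓝 (∫ y, f 0 y ^ α ∂ν)⁻¹) := by
  have h := ((hX.isNormalizing_iff a).1 ha).2.mul_const (∫ y, f 0 y ^ α ∂ν)⁻¹
  rw [one_mul] at h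
  refine h.congr fun n => ?_
  field_simp

theorem exists_isNormalizing (hX : IsMaxStableProcess ν P α Γ Y f X)
    (hC : 0 < ∫ y, f 0 y ^ α ∂ν) : ∃ a, IsNormalizing P (X 0) a := by
  set C := ∫ y, f 0 y ^ α ∂ν
  -- The solution a of n a^{-α} C = 1.
  refine ⟨fun n => ((n : ℝ) * C) ^ α⁻¹, (hX.isNormalizing_iff _).2 ⟨?_, ?_⟩⟩
  · exact (tendsto_rpow_atTop (inv_pos.2 hX.index_pos)).comp
      (tendsto_natCast_atTop_atTop.atTop_mul_const hC)
  · refine tendsto_const_nhds.congr' ?_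
    filter_upwards [eventually_gt_atTop 0] with n hn
    have hn' : (0 : ℝ) < n := by exact_mod_cast hn
    rw [← Real.rpow_mul (by positivity), inv_mul_eq_div, neg_div, div_self hX.index_pos.ne',
      Real.rpow_neg_one]
    field_simp
    rfl

theorem hasTailDependence (hX : IsMaxStableProcess ν P α Γ Y f X)
    (hC : 0 < ∫ y, f 0 y ^ α ∂ν) (h : ℕ) :
    HasTailDependence P X h
      ((∫ y, min (f 0 y ^ α) (f h y ^ α) ∂ν) / ∫ y, f 0 y ^ α ∂ν) := by
  -- Conditional probabilities are ratios, so any common rate cancels; x^α gives the limit constant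
  -- 1.
  have hr : Tendsto (fun x : ℝ => x ^ α) atTop atTop := tendsto_rpow_atTop hX.index_pos
  have hu : ∀ᶠ x : ℝ in atTop, 0 < x := eventually_gt_atTop 0
  have hc : Tendsto (fun x : ℝ => x ^ α * x ^ (-α)) atTop (𝓝 1) := by
    refine tendsto_const_nhds.congr' ?_
    filter_upwards [hu] with x hx
    rw [← Real.rpow_add hx, add_neg_cancel, Real.rpow_zero]
  have h1 := hX.tendsto_real_lt hr hu hc 0 one_pos
  have h2 := hX.tendsto_real_lt_and_lt hr hu hc 0 h one_pos one_pos
  simp only [mul_one, one_mul, Real.one_rpow, div_one] at h1 h2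
  refine (h2.div h1 hC.ne').congr' ?_
  filter_upwards [hu] with x hx
  have hm : MeasurableSet {ω | x < X 0 ω} :=
    _root_.measurableSet_lt measurable_const (hX.measurable_process _)
  rw [measureReal_def (ProbabilityTheory.cond _ _), cond_apply hm, ENNReal.toReal_mul,
    ENNReal.toReal_inv, ← measureReal_def, ← measureReal_def, inv_mul_eq_div]
  exact mul_div_mul_left _ _ (Real.rpow_pos_of_pos hx _).ne'

theorem covariance_indicator {A B : Set Ω} (hA : MeasurableSet A) (hB : MeasurableSet B) :
    cov[A.indicator (fun _ => (1 : ℝ)), B.indicator (fun _ => (1 : ℝ)); P]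
      = P.real (A ∩ B) - P.real A * P.real B := by
  rw [covariance_eq_sub (memLp_indicator_const 2 hA 1 (by simp))
    (memLp_indicator_const 2 hB 1 (by simp))]
  have : A.indicator (fun _ => (1 : ℝ)) * B.indicator (fun _ => (1 : ℝ))
      = (A ∩ B).indicator (fun _ => (1 : ℝ)) := by
    ext ω
    by_cases h1 : ω ∈ A <;> by_cases h2 : ω ∈ B <;> simp [h1, h2]
  rw [this, integral_indicator_const _ hA, integral_indicator_const _ hB,
    integral_indicator_const _ (hA.inter hB)]
  simp

theorem hasExtremogram (hX : IsMaxStableProcess ν P α Γ Y f X)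
    (hC : 0 < ∫ y, f 0 y ^ α ∂ν) {a b : ℝ} (ha : 0 < a) (hb : 0 < b) (h : ℕ) :
    HasExtremogram P X (Ioi a) (Ioi b) h
      ((∫ y, min (f 0 y ^ α) ((a / b * f h y) ^ α) ∂ν) / (a ^ α * ∫ y, f 0 y ^ α ∂ν)) := by
  intro u hu
  have hpos : ∀ᶠ n in atTop, 0 < u n := hu.1.eventually_gt_atTop 0
  have hc := hX.tendsto_of_isNormalizing hC hu
  have hr : Tendsto (fun n : ℕ => (n : ℝ)) atTop atTop := tendsto_natCast_atTop_atTop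
  have h1 := hX.tendsto_real_lt hr hpos hc 0 ha
  have h2 := hX.tendsto_real_lt hr hpos hc h hb
  have h3 := hX.tendsto_real_lt_and_lt hr hpos hc 0 h ha hb
  -- The product of the marginal probabilities vanishes: n p q = (n p)(n q) / n.
  have h4 := h3.sub ((h1.mul h2).mul hr.inv_tendsto_atTop)
  rw [mul_zero, sub_zero] at h4
  convert! h4.congr' ?_ using 2
  · have e : ∀ y, min ((f 0 y / a) ^ α) ((f h y / b) ^ α)
        = (a ^ α)⁻¹ * min (f 0 y ^ α) ((a / b * f h y) ^ α) := by
      intro y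
      have h0 := hX.nonneg 0 y
      have hh := hX.nonneg h y
      have : (f h y / b) = (a / b * f h y) / a := by field_simp
      rw [this, Real.div_rpow h0 ha.le, Real.div_rpow (by positivity) ha.le,
        mul_min_of_nonneg _ _ (by positivity), inv_mul_eq_div, inv_mul_eq_div]
    simp_rw [e]
    rw [integral_const_mul, div_eq_mul_inv, mul_inv]
    ring
  · filter_upwards [hpos, eventually_gt_atTop 0] with n hn hn0
    have hn' : (n : ℝ) ≠ 0 := by exact_mod_cast hn0.ne'
    have e1 : ∀ (t : ℤ) (a : ℝ), {ω | X t ω / u n ∈ Ioi a} = {ω | u n * a < X t ω} := by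
      intro t a; ext ω
      simp only [mem_Ioi, mem_ofPred_eq]
      rw [lt_div_iff₀ hn, mul_comm]
    rw [e1, e1, covariance_indicator
      (_root_.measurableSet_lt measurable_const (hX.measurable_process _))
      (_root_.measurableSet_lt measurable_const (hX.measurable_process _))]
    simp only [Pi.inv_apply]
    field_simp

/-! ### The extremal index -/

theorem iSup_exponent_nonneg (hX : IsMaxStableProcess ν P α Γ Y f X) (n : ℕ) :
    0 ≤ ∫ y, (⨆ t : Fin n, f ((t : ℤ) + 1) y ^ α) ∂ν :=
  integral_nonneg fun y => Real.iSup_nonneg fun _ => Real.rpow_nonneg (hX.nonneg _ y) _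

theorem iSup_exponent_le (hX : IsMaxStableProcess ν P α Γ Y f X) (hs : IsStrictlyStationary P X)
    (n : ℕ) : ∫ y, (⨆ t : Fin n, f ((t : ℤ) + 1) y ^ α) ∂ν ≤ n * ∫ y, f 0 y ^ α ∂ν := by
  have e : (n : ℝ) * ∫ y, f 0 y ^ α ∂ν
      = ∫ y, ∑ t : Fin n, f ((t : ℤ) + 1) y ^ α ∂ν := by
    rw [integral_finsetSum _ fun i _ => hX.integrable_rpow _]
    simp [hX.integral_rpow_eq hs]
  rw [e]
  refine integral_mono_of_nonneg (Eventually.of_forall fun y => Real.iSup_nonneg fun _ =>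
    Real.rpow_nonneg (hX.nonneg _ y) _) (integrable_finsetSum _ fun i _ => hX.integrable_rpow _)
    (Eventually.of_forall fun y => ?_)
  have h0 : ∀ t : Fin n, 0 ≤ f ((t : ℤ) + 1) y ^ α := fun t => Real.rpow_nonneg (hX.nonneg _ y) _
  exact Real.iSup_le (fun t => Finset.single_le_sum (f := fun t : Fin n => f ((t : ℤ) + 1) y ^ α)
    (fun t _ => h0 t) (Finset.mem_univ t)) (Finset.sum_nonneg fun t _ => h0 t)

theorem real_lagged_le (hX : IsMaxStableProcess ν P α Γ Y f X) (n : ℕ) {u : ℝ} (hu : 0 < u) :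
    P.real {ω | ∀ i : Fin n, lagged X n ω i ≤ u}
      = Real.exp (-(u ^ (-α) * ∫ y, (⨆ t : Fin n, f ((t : ℤ) + 1) y ^ α) ∂ν)) := by
  have h := tailExponent_smul (ν := ν) (α := α) hu (φ := fun i : Fin n => f ((i : ℤ) + 1))
    (fun i => hX.nonneg _) (x := fun _ => 1) (by simp)
  simp only [mul_one] at h
  have h2 := hX.real_forall_le (fun i : Fin n => (i : ℤ) + 1) (x := fun _ => u) fun _ => hu
  rw [h] at h2
  simpa [tailExponent, lagged] using h2

/-- The distribution function at 1/(n+1) is exp(-(n+1)^α ∫ f_t^α dν), which tends to 0. It serves to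
exclude nonpositive levels, for which the exact distribution function is not available. -/
theorem real_pos_eq_one (hX : IsMaxStableProcess ν P α Γ Y f X) {t : ℤ} (hC : 0 < ∫ y, f t y ^ α ∂ν) :
    P.real {ω | 0 < X t ω} = 1 := by
  have h1 : Tendsto (fun n : ℕ => Real.exp (-(((n : ℝ) + 1) ^ α * ∫ y, f t y ^ α ∂ν))) atTop
      (𝓝 0) := by
    refine Real.tendsto_exp_neg_atTop_nhds_zero.comp ?_
    exact ((tendsto_rpow_atTop hX.index_pos).comp
      (tendsto_atTop_add_const_right _ _ tendsto_natCast_atTop_atTop)).atTop_mul_const hC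
  have h2 : P.real {ω | X t ω ≤ 0} ≤ 0 := by
    refine ge_of_tendsto h1 (Eventually.of_forall fun n => ?_)
    have hn : (0 : ℝ) < n + 1 := by positivity
    have := hX.real_le t (inv_pos.2 hn)
    rw [Real.inv_rpow hn.le, Real.rpow_neg hn.le, inv_inv] at this
    rw [← this]
    exact measureReal_mono fun ω (hω : X t ω ≤ 0) => hω.trans (inv_pos.2 hn).le
  have h3 := probReal_compl_eq_one_sub (μ := P)
    (_root_.measurableSet_le (hX.measurable_process t) (measurable_const (a := (0 : ℝ))))
  rw [le_antisymm h2 measureReal_nonneg, sub_zero] at h3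
  rw [← h3]
  congr 1
  ext ω
  simp

theorem hasExtremalIndex_iff (hX : IsMaxStableProcess ν P α Γ Y f X)
    (hs : IsStrictlyStationary P X) (hC : 0 < ∫ y, f 0 y ^ α ∂ν) (θ : ℝ) :
    HasExtremalIndex P X θ ↔
      Tendsto (fun n : ℕ => 1 / (n : ℝ) *
        ((∫ y, (⨆ t : Fin n, f ((t : ℤ) + 1) y ^ α) ∂ν) / ∫ y, f 0 y ^ α ∂ν))
        atTop (𝓝 θ) := by
  set C := ∫ y, f 0 y ^ α ∂ν with hCdef
  have hr : Tendsto (fun n : ℕ => (n : ℝ)) atTop atTop := tendsto_natCast_atTop_atTop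
  have hlaw : ∀ {u : ℕ → ℝ} {n : ℕ}, 0 < n → 0 < u n →
      P.real {ω | ∀ i : Fin n, lagged X n ω i ≤ u n} =
        Real.exp (-((1 / (n : ℝ) * ((∫ y, (⨆ t : Fin n, f ((t : ℤ) + 1) y ^ α) ∂ν) / C)) *
          (n * (u n ^ (-α) * C)))) := by
    intro u n hn hu
    have hn' : (n : ℝ) ≠ 0 := by exact_mod_cast hn.ne'
    rw [hX.real_lagged_le n hu]
    congr 2
    field_simp
  constructor
  · rintro ⟨-, -, H⟩
    -- The quotient in the exponent does not involve τ, so the single value τ = 1 already determines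
    -- its limit.
    obtain ⟨u, hu1, hu2⟩ := H 1 one_pos
    -- A nonpositive level is exceeded with probability one, which would make n P(X_0 > u_n) = n ≥
    -- 2, although the limit is 1.
    have hupos : ∀ᶠ n in atTop, 0 < u n := by
      have hlt : ∀ᶠ n : ℕ in atTop, (n : ℝ) * P.real {ω | u n < X 0 ω} < 2 :=
        hu1.eventually_lt_const (by norm_num)
      filter_upwards [hlt, hr.eventually_ge_atTop 2] with n h1 h2
      by_contra! hneg
      have : (1 : ℝ) ≤ P.real {ω | u n < X 0 ω} := by
        rw [← hX.real_pos_eq_one hC]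
        exact measureReal_mono fun ω (hω : 0 < X 0 ω) => hneg.trans_lt hω
      nlinarith
    have hv : Tendsto (fun n : ℕ => (n : ℝ) * (u n ^ (-α) * C)) atTop (𝓝 1) := by
      rw [← tendsto_mul_one_sub_exp_iff hr]
      refine hu1.congr' ?_
      filter_upwards [hupos] with n hn
      rw [hX.real_lt 0 hn]
    have h3 : Tendsto (fun n : ℕ =>
        (1 / (n : ℝ) * ((∫ y, (⨆ t : Fin n, f ((t : ℤ) + 1) y ^ α) ∂ν) / C)) *
          (n * (u n ^ (-α) * C))) atTop (𝓝 θ) := by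
      have hlog := ((Real.continuousAt_log (Real.exp_ne_zero _)).tendsto.comp hu2).neg
      simp only [Real.log_exp, mul_one, neg_neg] at hlog
      refine hlog.congr' ?_
      filter_upwards [hupos, eventually_gt_atTop 0] with n hn hn0
      simp only [Function.comp_apply]
      rw [hlaw hn0 hn, Real.log_exp, neg_neg]
    have h4 := h3.div hv one_ne_zero
    rw [div_one] at h4
    refine h4.congr' ?_
    filter_upwards [hupos, eventually_gt_atTop 0] with n hn hn0
    have hn' : (0 : ℝ) < n := by exact_mod_cast hn0
    have : (0 : ℝ) < n * (u n ^ (-α) * C) := by positivity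
    exact mul_div_cancel_right₀ _ this.ne'
  · intro H
    refine ⟨ge_of_tendsto' H fun n => ?_, le_of_tendsto' H fun n => ?_, fun τ hτ => ?_⟩
    · have := hX.iSup_exponent_nonneg n
      positivity
    · have h1 := hX.iSup_exponent_le hs n
      rw [one_div, inv_mul_eq_div, div_div]
      refine div_le_one_of_le₀ (by rwa [mul_comm]) (by positivity)
    · have hv : ∀ n : ℕ, 0 < n → (n : ℝ) * ((((n : ℝ) * C / τ) ^ α⁻¹) ^ (-α) * C) = τ := by
        intro n hn
        have hn' : (0 : ℝ) < n := by exact_mod_cast hn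
        rw [← Real.rpow_mul (by positivity), inv_mul_eq_div, neg_div,
          div_self hX.index_pos.ne', Real.rpow_neg_one]
        field_simp
      have hupos : ∀ n : ℕ, 0 < n → 0 < ((n : ℝ) * C / τ) ^ α⁻¹ := by
        intro n hn
        have hn' : (0 : ℝ) < n := by exact_mod_cast hn
        positivity
      -- The level solving n u^{-α} C = τ, so that the exponent is exactly τ for each n > 0.
      refine ⟨fun n => ((n : ℝ) * C / τ) ^ α⁻¹, ?_, ?_⟩
      · have := (tendsto_mul_one_sub_exp_iff
          (v := fun n : ℕ => (((n : ℝ) * C / τ) ^ α⁻¹) ^ (-α) * C) (τ := τ) hr).2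
          (tendsto_const_nhds.congr' (by
            filter_upwards [eventually_gt_atTop 0] with n hn using (hv n hn).symm))
        refine this.congr' ?_
        filter_upwards [eventually_gt_atTop 0] with n hn
        rw [hX.real_lt 0 (hupos n hn)]
      · have := (Real.continuous_exp.tendsto _).comp (H.mul_const τ).neg
        refine this.congr' ?_
        filter_upwards [eventually_gt_atTop 0] with n hn
        rw [hlaw (u := fun n => ((n : ℝ) * C / τ) ^ α⁻¹) hn (hupos n hn), hv n hn]
        rfl

end IsMaxStableProcess

/-! ### Weak convergence away from the origin -/

section WeakConvergence

variable {h : ℕ} {κ : Type*} {l : Filter κ}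

/-- Zero coordinates are excluded because limit measures may charge the hyperplanes x_i = 0, where
convergence of distribution functions can fail. -/
theorem isPiSystem_Iic_ne_zero :
    IsPiSystem {s : Set (Fin h → ℝ) | ∃ w : Fin h → ℝ, (∀ i, w i ≠ 0) ∧ s = Iic w} := by
  rintro _ ⟨v, hv, rfl⟩ _ ⟨w, hw, rfl⟩ -
  refine ⟨v ⊓ w, fun i => ?_, Iic_inter_Iic⟩
  rcases min_choice (v i) (w i) with e | e <;> simp [e, hv i, hw i]

/-- Convergence of distribution functions implies convergence on rectangles. -/
theorem tendsto_real_rectangle {μs : κ → Measure (Fin h → ℝ)} {μ : Measure (Fin h → ℝ)}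
    [∀ k, IsFiniteMeasure (μs k)] [IsFiniteMeasure μ]
    (hIic : ∀ w : Fin h → ℝ, (∀ i, w i ≠ 0) →
      Tendsto (fun k => (μs k).real (Iic w)) l (𝓝 (μ.real (Iic w))))
    {u v : Fin h → ℝ} (hu : ∀ i, u i ≠ 0) (hv : ∀ i, v i ≠ 0) :
    Tendsto (fun k => (μs k).real {x | ∀ i, u i < x i ∧ x i ≤ v i}) l
      (𝓝 (μ.real {x | ∀ i, u i < x i ∧ x i ≤ v i})) := by
  classical
  -- The rectangle is the orthant below v minus the orthants where one coordinate of v is lowered to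
  -- that of u; inclusion-exclusion over the π-system handles their union. The minimum with `v i`
  -- keeps the lowered orthants inside when u_i > v_i.
  set T : Finset (Set (Fin h → ℝ)) :=
    Finset.univ.image fun i => Iic (Function.update v i (min (u i) (v i)))
  have hT : ∀ s ∈ T, s ∈ {s : Set (Fin h → ℝ) | ∃ w : Fin h → ℝ, (∀ i, w i ≠ 0) ∧ s = Iic w} := by
    intro s hs
    obtain ⟨i, -, rfl⟩ := Finset.mem_image.1 hs
    refine ⟨_, fun j => ?_, rfl⟩
    rcases eq_or_ne j i with rfl | hj
    · rw [Function.update_self]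
      rcases min_choice (u j) (v j) with e | e <;> simp [e, hu j, hv j]
    · rw [Function.update_of_ne hj]
      exact hv j
  have hmeas : ∀ s ∈ {s : Set (Fin h → ℝ) | ∃ w : Fin h → ℝ, (∀ i, w i ≠ 0) ∧ s = Iic w},
      MeasurableSet s := by
    rintro _ ⟨w, -, rfl⟩
    exact measurableSet_Iic
  have hlim := isPiSystem_Iic_ne_zero.tendsto_measureReal_biUnion (μ := μs) (ν := μ) (l := l) hT
    hmeas (by rintro _ ⟨w, hw, rfl⟩; exact hIic w hw) (fun _ _ => measure_ne_top _ _)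
    (fun _ _ _ => measure_ne_top _ _)
  have hsub : (⋃ s ∈ T, s) ⊆ Iic v := by
    simp only [T, Finset.mem_image, Finset.mem_univ, true_and, iUnion_exists,
      iUnion_iUnion_eq', iUnion_subset_iff]
    intro i
    refine Iic_subset_Iic.2 fun j => ?_
    rcases eq_or_ne j i with rfl | hj
    · simp
    · simp [hj]
  have hTm : MeasurableSet (⋃ s ∈ T, s) :=
    Finset.measurableSet_biUnion _ fun s hs => hmeas s (hT s hs)
  have hrect : {x : Fin h → ℝ | ∀ i, u i < x i ∧ x i ≤ v i} = Iic v \ ⋃ s ∈ T, s := by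
    ext x
    simp only [T, Finset.mem_image, Finset.mem_univ, true_and, iUnion_exists, iUnion_iUnion_eq',
      Set.mem_sdiff, mem_Iic, mem_iUnion, not_exists, mem_ofPred_eq]
    constructor
    · intro hx
      refine ⟨fun i => (hx i).2, fun i hi => ?_⟩
      have := hi i
      rw [Function.update_self] at this
      exact absurd (this.trans (min_le_left _ _)) (not_le.2 (hx i).1)
    · rintro ⟨hx, hn⟩ i
      refine ⟨?_, hx i⟩
      by_contra! hi
      refine hn i fun j => ?_
      rcases eq_or_ne j i with rfl | hj
      · simpa using ⟨hi, hx j⟩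
      · simpa [hj] using hx j
  have hdiff : ∀ (Q : Measure (Fin h → ℝ)) [IsFiniteMeasure Q],
      Q.real (Iic v \ ⋃ s ∈ T, s) = Q.real (Iic v) - Q.real (⋃ s ∈ T, s) :=
    fun Q _ => measureReal_sdiff hsub hTm
  simp_rw [hrect, hdiff]
  exact (hIic v hv).sub hlim

theorem exists_rectangle_subset {u : Set (Fin h → ℝ)} (hu : IsOpen u) {x : Fin h → ℝ}
    (hx : x ∈ u) : ∃ a b : Fin h → ℝ, (∀ i, a i ≠ 0) ∧ (∀ i, b i ≠ 0) ∧
      {y | ∀ i, a i < y i ∧ y i ≤ b i} ∈ 𝓝 x ∧ {y | ∀ i, a i < y i ∧ y i ≤ b i} ⊆ u := by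
  obtain ⟨ε, hε, hball⟩ := Metric.isOpen_iff.1 hu x hx
  have ha : ∀ i, ∃ a, a ≠ 0 ∧ x i - ε < a ∧ a < x i := by
    intro i
    by_cases h0 : x i - ε / 2 = 0
    · exact ⟨x i - ε / 4, by intro h; linarith, by linarith, by linarith⟩
    · exact ⟨x i - ε / 2, h0, by linarith, by linarith⟩
  have hb : ∀ i, ∃ b, b ≠ 0 ∧ x i < b ∧ b < x i + ε := by
    intro i
    by_cases h0 : x i + ε / 2 = 0
    · exact ⟨x i + ε / 4, by intro h; linarith, by linarith, by linarith⟩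
    · exact ⟨x i + ε / 2, h0, by linarith, by linarith⟩
  choose a ha0 ha1 ha2 using ha
  choose b hb0 hb1 hb2 using hb
  refine ⟨a, b, ha0, hb0, ?_, fun y hy => hball ?_⟩
  · have : Set.pi univ (fun i => Ioo (a i) (b i)) ∈ 𝓝 x :=
      set_pi_mem_nhds finite_univ fun i _ => Ioo_mem_nhds (ha2 i) (hb1 i)
    filter_upwards [this] with y hy i
    exact ⟨(hy i (mem_univ i)).1, (hy i (mem_univ i)).2.le⟩
  · rw [Metric.mem_ball, dist_pi_lt_iff hε]
    intro i
    rw [Real.dist_eq, abs_lt]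
    constructor <;> linarith [(hy i).1, (hy i).2, ha1 i, hb2 i]

/-- Finite measures on `ℝ^h` whose total masses converge and whose distribution functions converge
at the points without zero coordinates converge weakly. -/
theorem tendsto_integral_of_tendsto_real_Iic [l.IsCountablyGenerated]
    {μs : κ → Measure (Fin h → ℝ)} {μ : Measure (Fin h → ℝ)}
    [∀ k, IsFiniteMeasure (μs k)] [IsFiniteMeasure μ] (hμ : μ ≠ 0)
    (huniv : Tendsto (fun k => (μs k).real univ) l (𝓝 (μ.real univ)))
    (hIic : ∀ w : Fin h → ℝ, (∀ i, w i ≠ 0) →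
      Tendsto (fun k => (μs k).real (Iic w)) l (𝓝 (μ.real (Iic w))))
    (g : BoundedContinuousFunction (Fin h → ℝ) ℝ) :
    Tendsto (fun k => ∫ x, g x ∂(μs k)) l (𝓝 (∫ x, g x ∂μ)) := by
  set F : κ → FiniteMeasure (Fin h → ℝ) := fun k => ⟨μs k, inferInstance⟩
  set F₀ : FiniteMeasure (Fin h → ℝ) := ⟨μ, inferInstance⟩
  have hF₀ : F₀ ≠ 0 := fun h => hμ (congrArg Subtype.val h)
  have hmass : Tendsto (fun k => (F k).mass) l (𝓝 F₀.mass) := by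
    rw [← NNReal.tendsto_coe]
    exact huniv
  have hmass0 : F₀.mass ≠ 0 := F₀.mass_nonzero_iff.2 hF₀
  have hne : ∀ᶠ k in l, F k ≠ 0 := by
    filter_upwards [hmass.eventually_ne hmass0] with k hk
    exact (F k).mass_nonzero_iff.1 hk
  have hpi : IsPiSystem {s : Set (Fin h → ℝ) | ∃ a b : Fin h → ℝ, (∀ i, a i ≠ 0) ∧
      (∀ i, b i ≠ 0) ∧ s = {y | ∀ i, a i < y i ∧ y i ≤ b i}} := by
    rintro _ ⟨a, b, ha, hb, rfl⟩ _ ⟨a', b', ha', hb', rfl⟩ -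
    refine ⟨a ⊔ a', b ⊓ b', fun i => ?_, fun i => ?_, ?_⟩
    · rcases max_choice (a i) (a' i) with e | e <;> simp [e, ha i, ha' i]
    · rcases min_choice (b i) (b' i) with e | e <;> simp [e, hb i, hb' i]
    · ext y
      simp only [mem_inter_iff, mem_ofPred_eq, Pi.sup_apply, Pi.inf_apply, sup_lt_iff, le_inf_iff,
        ← forall_and]
      exact forall_congr' fun i => by tauto
  -- The π-system criterion is for probability measures. Nonzero limit mass allows normalization,
  -- and the convergence of masses undoes it.
  have hnorm : Tendsto (fun k => (F k).normalize) l (𝓝 F₀.normalize) := by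
    refine hpi.tendsto_probabilityMeasure_of_tendsto_of_mem ?_ ?_ ?_
    · rintro _ ⟨a, b, -, -, rfl⟩
      simp only [ofPred_forall]
      exact MeasurableSet.iInter fun i =>
        (measurableSet_lt measurable_const (measurable_pi_apply i)).inter
          (measurableSet_le (measurable_pi_apply i) measurable_const)
    · intro u hu x hx
      obtain ⟨a, b, ha, hb, h1, h2⟩ := exists_rectangle_subset hu hx
      exact ⟨_, ⟨a, b, ha, hb, rfl⟩, h1, h2⟩
    · rintro _ ⟨a, b, ha, hb, rfl⟩
      have h1 : Tendsto (fun k => F k {y | ∀ i, a i < y i ∧ y i ≤ b i}) l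
          (𝓝 (F₀ {y | ∀ i, a i < y i ∧ y i ≤ b i})) := by
        rw [← NNReal.tendsto_coe]
        exact tendsto_real_rectangle hIic ha hb
      rw [F₀.normalize_eq_of_nonzero hF₀]
      refine ((hmass.inv₀ hmass0).mul h1).congr' ?_
      filter_upwards [hne] with k hk
      rw [(F k).normalize_eq_of_nonzero hk]
  exact FiniteMeasure.tendsto_iff_forall_integral_tendsto.1
    (FiniteMeasure.tendsto_of_tendsto_normalize_testAgainstNN_of_tendsto_mass hnorm hmass) g

/-- The complement of the orthant with corner `w`. -/
def upperTail (w : Fin h → ℝ) : Set (Fin h → ℝ) :=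
  {x | ∃ i, w i < x i}

theorem measurableSet_upperTail (w : Fin h → ℝ) : MeasurableSet (upperTail w) := by
  simp only [upperTail, ofPred_exists]
  exact MeasurableSet.iUnion fun i => measurableSet_lt measurable_const (measurable_pi_apply i)

/-- A point below w that leaves the box of side ε is exactly a point that leaves the box min(w, ε)
but not the box w. -/
theorem real_restrict_upperTail_Iic {ρ : Measure (Fin h → ℝ)}
    (hfin : ∀ w : Fin h → ℝ, (∀ i, 0 < w i) → ρ (upperTail w) ≠ ∞) {ε : ℝ} (hε : 0 < ε)
    {w : Fin h → ℝ} (hw : ∀ i, 0 < w i) :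
    (ρ.restrict (upperTail fun _ => ε)).real (Iic w)
      = ρ.real (upperTail fun i => min (w i) ε) - ρ.real (upperTail w) := by
  have hsub : upperTail w ⊆ upperTail fun i => min (w i) ε := by
    rintro x ⟨i, hi⟩
    exact ⟨i, (min_le_left _ _).trans_lt hi⟩
  rw [← measureReal_sdiff hsub (measurableSet_upperTail w) (hfin _ fun i => lt_min (hw i) hε),
    measureReal_restrict_apply measurableSet_Iic]
  congr 1
  ext x
  simp only [upperTail, mem_inter_iff, mem_Iic, mem_ofPred_eq, Set.mem_sdiff, not_exists, not_lt,
    Pi.le_def]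
  constructor
  · rintro ⟨hx, i, hi⟩
    exact ⟨⟨i, (min_le_right _ _).trans_lt hi⟩, hx⟩
  · rintro ⟨⟨i, hi⟩, hx⟩
    refine ⟨hx, i, ?_⟩
    rcases min_lt_iff.1 hi with h1 | h1
    · exact absurd h1 (not_lt.2 (hx i))
    · exact h1

/-- For nonnegative vectors, not leaving the box of side ε means sup norm at most ε, where g
vanishes. -/
theorem integral_restrict_upperTail {ρ : Measure (Fin h → ℝ)}
    (hneg : ∀ᵐ x ∂ρ, ∀ i, 0 ≤ x i) {ε : ℝ} {g : (Fin h → ℝ) → ℝ}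
    (hg : ∀ x, ‖x‖ ≤ ε → g x = 0) (hε : 0 < ε) :
    ∫ x in upperTail (fun _ => ε), g x ∂ρ = ∫ x, g x ∂ρ := by
  refine setIntegral_eq_integral_of_ae_compl_eq_zero ?_
  filter_upwards [hneg] with x hx hxt
  refine hg x ((pi_norm_le_iff_of_nonneg hε.le).2 fun i => ?_)
  rw [Real.norm_of_nonneg (hx i)]
  by_contra! hi
  exact hxt ⟨i, hi⟩

/-- Vague convergence on the punctured nonnegative orthant follows from the convergence of the
measures of the complements of the rectangles `[0, w]`. -/
theorem tendsto_integral_of_tendsto_upperTail [l.IsCountablyGenerated]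
    {ρ : κ → Measure (Fin h → ℝ)} {ρ₀ : Measure (Fin h → ℝ)}
    (hneg : ∀ᶠ k in l, ∀ᵐ x ∂(ρ k), ∀ i, 0 ≤ x i) (hneg₀ : ∀ᵐ x ∂ρ₀, ∀ i, 0 ≤ x i)
    (hfin : ∀ k, ∀ w : Fin h → ℝ, (∀ i, 0 < w i) → ρ k (upperTail w) ≠ ∞)
    (hfin₀ : ∀ w : Fin h → ℝ, (∀ i, 0 < w i) → ρ₀ (upperTail w) ≠ ∞)
    (hpos : ∀ ε : ℝ, 0 < ε → ρ₀ (upperTail fun _ => ε) ≠ 0)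
    (hlim : ∀ w : Fin h → ℝ, (∀ i, 0 < w i) →
      Tendsto (fun k => (ρ k).real (upperTail w)) l (𝓝 (ρ₀.real (upperTail w))))
    (g : BoundedContinuousFunction (Fin h → ℝ) ℝ) {ε : ℝ} (hε : 0 < ε)
    (hg : ∀ x, ‖x‖ ≤ ε → g x = 0) :
    Tendsto (fun k => ∫ x, g x ∂(ρ k)) l (𝓝 (∫ x, g x ∂ρ₀)) := by
  have : ∀ k, IsFiniteMeasure ((ρ k).restrict (upperTail fun _ => ε)) := fun k =>
    ⟨by rw [Measure.restrict_apply_univ]; exact (hfin k _ fun _ => hε).lt_top⟩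
  have : IsFiniteMeasure (ρ₀.restrict (upperTail fun _ => ε)) :=
    ⟨by rw [Measure.restrict_apply_univ]; exact (hfin₀ _ fun _ => hε).lt_top⟩
  have hnull : ∀ {S : Measure (Fin h → ℝ)} {w : Fin h → ℝ}, (∀ᵐ x ∂S, ∀ i, 0 ≤ x i) →
      (∃ i, w i < 0) → (S.restrict (upperTail fun _ => ε)).real (Iic w) = 0 := by
    rintro S w hQ ⟨i, hi⟩
    have h0 : S (Iic w) = 0 := by
      refine measure_mono_null (fun x (hx : x ≤ w) => ?_) (ae_iff.1 hQ)
      intro hx'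
      exact absurd (hx' i) (not_le.2 ((hx i).trans_lt hi))
    rw [measureReal_def, nonpos_iff_eq_zero.1 ((Measure.restrict_apply_le _ _).trans h0.le),
      ENNReal.toReal_zero]
  have key := tendsto_integral_of_tendsto_real_Iic (l := l)
    (μs := fun k => (ρ k).restrict (upperTail fun _ => ε))
    (μ := ρ₀.restrict (upperTail fun _ => ε)) ?_ ?_ ?_ g
  · rw [integral_restrict_upperTail hneg₀ hg hε] at key
    refine key.congr' ?_
    filter_upwards [hneg] with k hk
    rw [integral_restrict_upperTail hk hg hε]
  · intro h0
    refine hpos ε hε ?_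
    rw [← Measure.restrict_apply_univ, h0, Measure.coe_zero, Pi.zero_apply]
  · simp_rw [measureReal_restrict_apply_univ]
    exact hlim _ fun _ => hε
  · intro w hw
    by_cases hpw : ∀ i, 0 < w i
    · simp_rw [fun k => real_restrict_upperTail_Iic (hfin k) hε hpw,
        real_restrict_upperTail_Iic hfin₀ hε hpw]
      exact (hlim _ fun i => lt_min (hpw i) hε).sub (hlim _ hpw)
    -- A corner with nonzero coordinates that are not all positive has a negative one, and such an
    -- orthant is null for measures carried by nonnegative vectors.
    · push Not at hpw
      obtain ⟨i, hi⟩ := hpw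
      have hex : ∃ i, w i < 0 := ⟨i, lt_of_le_of_ne hi (hw i)⟩
      rw [hnull hneg₀ hex]
      refine tendsto_const_nhds.congr' ?_
      filter_upwards [hneg] with k hk
      rw [hnull hk hex]

end WeakConvergence

/-! ### Measures on the punctured extended space -/

/-- The embedding of `ℝ^h` into `[-∞, ∞]^h`. -/
def toExtended {h : ℕ} (x : Fin h → ℝ) : Fin h → EReal := fun i => (x i : EReal)

theorem continuous_toExtended {h : ℕ} : Continuous (toExtended (h := h)) :=
  continuous_pi fun i => continuous_coe_real_ereal.comp (continuous_apply i)

theorem measurable_toExtended {h : ℕ} : Measurable (toExtended (h := h)) :=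
  measurable_pi_lambda _ fun i => measurable_coe_real_ereal.comp (measurable_pi_apply i)

theorem toExtended_zero {h : ℕ} : toExtended (0 : Fin h → ℝ) = 0 := by
  ext i; simp [toExtended]

theorem measurableSet_ne_zero {h : ℕ} : MeasurableSet {y : Fin h → EReal | y ≠ 0} :=
  (measurableSet_singleton (0 : Fin h → EReal)).compl

theorem measurableEmbedding_punctured {h : ℕ} :
    MeasurableEmbedding (Subtype.val : Punctured h → Fin h → EReal) :=
  MeasurableEmbedding.subtype_coe measurableSet_ne_zero

/-- The restriction to `[-∞, ∞]^h \ {0}` of the image of a measure on `ℝ^h`. -/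
noncomputable def puncturedMeasure {h : ℕ} (ρ : Measure (Fin h → ℝ)) : Measure (Punctured h) :=
  (ρ.map toExtended).comap Subtype.val

section Punctured

variable {h : ℕ} {ρ : Measure (Fin h → ℝ)}

theorem puncturedMeasure_apply {A : Set (Punctured h)} (hA : MeasurableSet A) :
    puncturedMeasure ρ A = ρ (toExtended ⁻¹' (Subtype.val '' A)) := by
  rw [puncturedMeasure, measurableEmbedding_punctured.comap_apply,
    Measure.map_apply measurable_toExtended
      (measurableEmbedding_punctured.measurableSet_image.2 hA)]

/-- Extending the test function by 0 at the removed origin moves the integral to ℝ^h without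
changing it. -/
theorem integral_puncturedMeasure {g : Punctured h → ℝ} (hg : Measurable g) :
    ∫ y, g y ∂(puncturedMeasure ρ)
      = ∫ x, Function.extend Subtype.val g 0 (toExtended x) ∂ρ := by
  have hinj : Function.Injective (Subtype.val : Punctured h → Fin h → EReal) :=
    Subtype.val_injective
  have hm : Measurable (Function.extend (Subtype.val : Punctured h → Fin h → EReal) g 0) :=
    measurableEmbedding_punctured.measurable_extend hg measurable_zero
  rw [← integral_map measurable_toExtended.aemeasurable hm.aestronglyMeasurable]
  have h1 : ∫ y, g y ∂(puncturedMeasure ρ)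
      = ∫ y, Function.extend (Subtype.val : Punctured h → Fin h → EReal) g 0 y.1
          ∂(puncturedMeasure ρ) := by
    congr 1 with y
    rw [hinj.extend_apply]
  rw [h1, ← measurableEmbedding_punctured.integral_map, puncturedMeasure,
    measurableEmbedding_punctured.map_comap]
  refine setIntegral_eq_integral_of_forall_compl_eq_zero fun y hy => ?_
  rw [Function.extend_apply' _ _ _ hy]
  rfl

theorem continuous_extend_punctured {g : Punctured h → ℝ} (hg : Continuous g)
    (hc : HasCompactSupport g) : Continuous (Function.extend Subtype.val g 0) :=
  hc.continuous_extend_zero (U := {y : Fin h → EReal | y ≠ 0})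
    isOpen_compl_singleton hg

/-- A compact subset of the punctured space is bounded away from the origin. -/
theorem exists_norm_le_notMem {K : Set (Punctured h)} (hK : IsCompact K) :
    ∃ ε : ℝ, 0 < ε ∧ ∀ x : Fin h → ℝ, ‖x‖ ≤ ε → toExtended x ∉ Subtype.val '' K := by
  -- The compact set stays compact, hence closed, in the full space, and it misses the origin; its
  -- complement contains a ball of finite vectors.
  have hcl : IsClosed (Subtype.val '' K : Set (Fin h → EReal)) :=
    (hK.image continuous_subtype_val).isClosed
  have h0 : (0 : Fin h → ℝ) ∈ toExtended ⁻¹' (Subtype.val '' K)ᶜ := by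
    rintro ⟨y, -, hy⟩
    exact y.2 (hy.trans toExtended_zero)
  obtain ⟨ε, hε, hb⟩ := Metric.isOpen_iff.1 (hcl.isOpen_compl.preimage continuous_toExtended) 0 h0
  refine ⟨ε / 2, half_pos hε, fun x hx => hb ?_⟩
  rw [mem_ball_zero_iff]
  linarith

theorem exists_norm_le_extend_eq_zero {g : Punctured h → ℝ} (hc : HasCompactSupport g) :
    ∃ ε : ℝ, 0 < ε ∧ ∀ x : Fin h → ℝ, ‖x‖ ≤ ε →
      Function.extend Subtype.val g 0 (toExtended x) = 0 := by
  obtain ⟨ε, hε, hb⟩ := exists_norm_le_notMem hc.isCompact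
  refine ⟨ε, hε, fun x hx => ?_⟩
  by_cases hex : ∃ y : Punctured h, y.1 = toExtended x
  · obtain ⟨y, hy⟩ := hex
    rw [← hy, Subtype.val_injective.extend_apply]
    by_contra hne
    exact hb x hx ⟨y, subset_tsupport _ hne, hy⟩
  · rw [Function.extend_apply' _ _ _ hex]
    rfl

/-- The function on `ℝ^h` induced by a continuous function with compact support. -/
theorem exists_boundedContinuous {g : Punctured h → ℝ} (hg : Continuous g)
    (hc : HasCompactSupport g) : ∃ G : BoundedContinuousFunction (Fin h → ℝ) ℝ,
      ∀ x, G x = Function.extend Subtype.val g 0 (toExtended x) :=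
  ⟨(BoundedContinuousFunction.mkOfCompact
    ⟨_, continuous_extend_punctured hg hc⟩).compContinuous ⟨_, continuous_toExtended⟩, fun _ => rfl⟩

/-- Vague convergence of the restrictions to the punctured space. -/
theorem vagueTendsto_puncturedMeasure {ρ : ℕ → Measure (Fin h → ℝ)} {ρ₀ : Measure (Fin h → ℝ)}
    (hneg : ∀ᶠ k in atTop, ∀ᵐ x ∂(ρ k), ∀ i, 0 ≤ x i) (hneg₀ : ∀ᵐ x ∂ρ₀, ∀ i, 0 ≤ x i)
    (hfin : ∀ k, ∀ w : Fin h → ℝ, (∀ i, 0 < w i) → ρ k (upperTail w) ≠ ∞)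
    (hfin₀ : ∀ w : Fin h → ℝ, (∀ i, 0 < w i) → ρ₀ (upperTail w) ≠ ∞)
    (hpos : ∀ ε : ℝ, 0 < ε → ρ₀ (upperTail fun _ => ε) ≠ 0)
    (hlim : ∀ w : Fin h → ℝ, (∀ i, 0 < w i) →
      Tendsto (fun k => (ρ k).real (upperTail w)) atTop (𝓝 (ρ₀.real (upperTail w)))) :
    VagueTendsto (fun k => puncturedMeasure (ρ k)) (puncturedMeasure ρ₀) := by
  intro g hg hc
  obtain ⟨ε, hε, hb⟩ := exists_norm_le_extend_eq_zero hc
  obtain ⟨G, hG⟩ := exists_boundedContinuous hg hc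
  have key := tendsto_integral_of_tendsto_upperTail hneg hneg₀ hfin hfin₀ hpos hlim G hε
    fun x hx => (hG x).trans (hb x hx)
  simp_rw [integral_puncturedMeasure hg.measurable]
  simpa only [hG] using key

theorem puncturedMeasure_compact_lt_top (hneg : ∀ᵐ x ∂ρ, ∀ i, 0 ≤ x i)
    (hfin : ∀ w : Fin h → ℝ, (∀ i, 0 < w i) → ρ (upperTail w) ≠ ∞) {K : Set (Punctured h)}
    (hK : IsCompact K) : puncturedMeasure ρ K < ∞ := by
  obtain ⟨ε, hε, hb⟩ := exists_norm_le_notMem hK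
  rw [puncturedMeasure_apply hK.measurableSet]
  refine lt_of_le_of_lt (measure_mono_ae ?_) (hfin (fun _ => ε) fun _ => hε).lt_top
  filter_upwards [hneg] with x hx hxK
  by_contra hn
  refine hb x ((pi_norm_le_iff_of_nonneg hε.le).2 fun i => ?_) hxK
  rw [Real.norm_of_nonneg (hx i)]
  by_contra! hi
  exact hn ⟨i, hi⟩

theorem puncturedMeasure_infinite :
    puncturedMeasure ρ {y | ∃ i, y.1 i = ⊤ ∨ y.1 i = ⊥} = 0 := by
  have hm : MeasurableSet {y : Punctured h | ∃ i, y.1 i = ⊤ ∨ y.1 i = ⊥} := by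
    simp only [ofPred_exists]
    refine MeasurableSet.iUnion fun i => ?_
    have : Measurable fun y : Punctured h => y.1 i :=
      (measurable_pi_apply i).comp measurable_subtype_coe
    exact (this (measurableSet_singleton ⊤)).union (this (measurableSet_singleton ⊥))
  rw [puncturedMeasure_apply hm]
  convert! measure_empty (μ := ρ)
  ext x
  simp only [mem_preimage, mem_image, mem_empty_iff_false, iff_false]
  rintro ⟨y, ⟨i, hi⟩, hy⟩
  have : y.1 i = (x i : EReal) := congrFun hy i
  rw [this] at hi
  simp at hi

theorem puncturedMeasure_compl_rectangle (hneg : ∀ᵐ x ∂ρ, ∀ i, 0 ≤ x i) {w : Fin h → ℝ}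
    (hw : ∀ i, 0 < w i) :
    puncturedMeasure ρ {y | ¬ ∀ i, 0 ≤ y.1 i ∧ y.1 i ≤ (w i : EReal)} = ρ (upperTail w) := by
  have hm : MeasurableSet {y : Punctured h | ¬ ∀ i, 0 ≤ y.1 i ∧ y.1 i ≤ (w i : EReal)} := by
    refine MeasurableSet.compl (s := {y : Punctured h | ∀ i, 0 ≤ y.1 i ∧ y.1 i ≤ (w i : EReal)}) ?_
    simp only [ofPred_forall]
    refine MeasurableSet.iInter fun i => ?_
    have : Measurable fun y : Punctured h => y.1 i :=
      (measurable_pi_apply i).comp measurable_subtype_coe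
    exact (measurableSet_le measurable_const this).inter (measurableSet_le this measurable_const)
  rw [puncturedMeasure_apply hm]
  refine measure_congr ?_
  filter_upwards [hneg] with x hx
  refine propext ?_
  change toExtended x ∈ Subtype.val '' {y : Punctured h | _} ↔ ∃ i, w i < x i
  constructor
  · rintro ⟨y, hy, hyx⟩
    have e : ∀ i, y.1 i = (x i : EReal) := fun i => congrFun hyx i
    simp only [mem_ofPred_eq, e, EReal.coe_nonneg, EReal.coe_le_coe_iff] at hy
    by_contra! hn
    exact hy fun i => ⟨hx i, hn i⟩
  · rintro ⟨i, hi⟩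
    have hne : toExtended x ≠ 0 := by
      intro h0
      have : (x i : EReal) = 0 := congrFun h0 i
      rw [EReal.coe_eq_zero] at this
      linarith [hw i]
    refine ⟨⟨toExtended x, hne⟩, fun hall => ?_, rfl⟩
    have : (x i : EReal) ≤ (w i : EReal) := (hall i).2
    rw [EReal.coe_le_coe_iff] at this
    linarith

theorem coe_mul_coe_inv_mul {t : ℝ} (ht : t ≠ 0) (z : EReal) :
    (t : EReal) * (((t⁻¹ : ℝ) : EReal) * z) = z := by
  rw [← mul_assoc, ← EReal.coe_mul, mul_inv_cancel₀ ht, EReal.coe_one, one_mul]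

/-- Multiplication by a positive real is invertible on the extended line, infinite values included,
so the dilated set is the preimage of A under multiplication by t⁻¹. -/
theorem puncturedMeasure_scale {c : ℝ≥0∞} {t : ℝ} (ht : 0 < t)
    (hρ : ∀ D : Set (Fin h → ℝ), MeasurableSet D → ρ {x | t⁻¹ • x ∈ D} = c * ρ D)
    {A : Set (Punctured h)} (hA : MeasurableSet A) :
    puncturedMeasure ρ {y | ∃ z ∈ A, ∀ i, y.1 i = (t : EReal) * z.1 i}
      = c * puncturedMeasure ρ A := by
  have hA' : MeasurableSet (Subtype.val '' A : Set (Fin h → EReal)) :=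
    measurableEmbedding_punctured.measurableSet_image.2 hA
  set T : Set (Punctured h) := {y | ∃ z ∈ A, ∀ i, y.1 i = (t : EReal) * z.1 i}
  have hiff : ∀ y : Punctured h, y ∈ T ↔
      (fun i => ((t⁻¹ : ℝ) : EReal) * y.1 i) ∈ (Subtype.val '' A : Set (Fin h → EReal)) := by
    intro y
    constructor
    · rintro ⟨z, hz, hyz⟩
      refine ⟨z, hz, funext fun i => ?_⟩
      have := coe_mul_coe_inv_mul (inv_ne_zero ht.ne') (z.1 i)
      rw [inv_inv] at this
      rw [hyz i, this]
    · rintro ⟨z, hz, hyz⟩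
      refine ⟨z, hz, fun i => ?_⟩
      rw [hyz, coe_mul_coe_inv_mul ht.ne']
  have hT : MeasurableSet T := by
    have hmeas : Measurable fun (y : Punctured h) (i : Fin h) => ((t⁻¹ : ℝ) : EReal) * y.1 i :=
      measurable_pi_lambda _ fun i => measurable_const.mul
        ((measurable_pi_apply i).comp measurable_subtype_coe)
    have : T = (fun (y : Punctured h) (i : Fin h) => ((t⁻¹ : ℝ) : EReal) * y.1 i) ⁻¹'
        (Subtype.val '' A) := by
      ext y; exact hiff y
    rw [this]
    exact hmeas hA'
  rw [puncturedMeasure_apply hT, puncturedMeasure_apply hA, ← hρ _ (measurable_toExtended hA')]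
  congr 1
  ext x
  have hx : toExtended (t⁻¹ • x) = fun i => ((t⁻¹ : ℝ) : EReal) * (x i : EReal) := by
    ext i
    simp [toExtended]
  simp only [mem_preimage, mem_ofPred_eq, hx]
  constructor
  · rintro ⟨y, hy, hyx⟩
    have := (hiff y).1 hy
    rw [hyx] at this
    exact this
  · intro hmem
    have hne : toExtended x ≠ 0 := by
      intro h0
      obtain ⟨z, -, hz⟩ := hmem
      refine z.2 (hz.trans (funext fun i => ?_))
      have : (x i : EReal) = 0 := congrFun h0 i
      simp [this]
    exact ⟨⟨toExtended x, hne⟩, (hiff _).2 hmem, rfl⟩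

end Punctured

/-! ### The limit measures and regular variation -/

section Limit

variable {E : Type*} [MeasurableSpace E] {ν : Measure E} [SigmaFinite ν]

theorem ae_intensity_pos : ∀ᵐ p ∂(intensity ν), 0 < p.1 := by
  rw [ae_iff]
  have : {p : ℝ × E | ¬ 0 < p.1} = Iic 0 ×ˢ univ := by
    ext p; simp
  rw [this, intensity, Measure.prod_prod, Measure.restrict_apply measurableSet_Iic]
  have : Iic (0 : ℝ) ∩ Ioi 0 = ∅ := by
    ext; simp
  rw [this]
  simp

/-- Substitution in the first coordinate: Lebesgue measure on the half-line is scaled by c⁻¹ on each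
slice. -/
theorem intensity_scale {c : ℝ} (hc : 0 < c) {D : Set (ℝ × E)} (hD : MeasurableSet D) :
    intensity ν {p | (c * p.1, p.2) ∈ D} = ENNReal.ofReal c⁻¹ * intensity ν D := by
  have hm : Measurable fun p : ℝ × E => (c * p.1, p.2) := by fun_prop
  change intensity ν ((fun p : ℝ × E => (c * p.1, p.2)) ⁻¹' D) = _
  rw [intensity, Measure.prod_apply_symm hD, Measure.prod_apply_symm (hm hD),
    ← lintegral_const_mul' _ _ ENNReal.ofReal_ne_top]
  refine lintegral_congr fun y => ?_
  have h1 : MeasurableSet ((fun x : ℝ => (x, y)) ⁻¹' D) := hD.preimage (by fun_prop)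
  change (volume : Measure ℝ).restrict (Ioi 0) ((fun x => c * x) ⁻¹' ((fun x => (x, y)) ⁻¹' D)) = _
  rw [Measure.restrict_apply h1, Measure.restrict_apply (h1.preimage (measurable_const_mul c)),
    ← abs_of_pos (inv_pos.2 hc), ← Real.volume_preimage_mul_left hc.ne']
  congr 1
  ext x
  simp [hc]

/-- The vector `(g ^ (-1/α) f_i(y))_{i = 1, …, h}` of a point `(g, y)`. -/
noncomputable def pointVector (α : ℝ) (f : ℤ → E → ℝ) (h : ℕ) (p : ℝ × E) : Fin h → ℝ :=
  fun i => p.1 ^ (-(1 / α)) * f ((i : ℤ) + 1) p.2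

/-- The limit measure on `ℝ^h` of the finite-dimensional distributions. -/
noncomputable def limitMeasure (ν : Measure E) (α : ℝ) (f : ℤ → E → ℝ) (h : ℕ) :
    Measure (Fin h → ℝ) :=
  (ENNReal.ofReal (∫ y, f 0 y ^ α ∂ν)⁻¹ • intensity ν).map (pointVector α f h)

end Limit

namespace IsMaxStableProcess

variable {E Ω : Type*} [MeasurableSpace E] [MeasurableSpace Ω] {ν : Measure E} [SigmaFinite ν]
  {P : Measure Ω} [IsProbabilityMeasure P] {α : ℝ} {Γ : ℕ → Ω → ℝ} {Y : ℕ → Ω → E}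
  {f : ℤ → E → ℝ} {X : ℤ → Ω → ℝ}

theorem measurable_pointVector (hX : IsMaxStableProcess ν P α Γ Y f X) (h : ℕ) :
    Measurable (pointVector α f h) :=
  measurable_pi_lambda _ fun _ => (measurable_fst.pow_const _).mul
    ((hX.measurable _).comp measurable_snd)

theorem ae_limitMeasure_nonneg (hX : IsMaxStableProcess ν P α Γ Y f X) (h : ℕ) :
    ∀ᵐ x ∂(limitMeasure ν α f h), ∀ i, 0 ≤ x i := by
  have hm : MeasurableSet {x : Fin h → ℝ | ∀ i, 0 ≤ x i} := by
    simp only [ofPred_forall]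
    exact MeasurableSet.iInter fun i =>
      _root_.measurableSet_le measurable_const (measurable_pi_apply i)
  rw [limitMeasure, ae_map_iff (hX.measurable_pointVector h).aemeasurable hm]
  refine Measure.ae_smul_measure ?_ _
  filter_upwards [ae_intensity_pos] with p hp i
  exact mul_nonneg (Real.rpow_nonneg hp.le _) (hX.nonneg _ _)

theorem limitMeasure_upperTail (hX : IsMaxStableProcess ν P α Γ Y f X)
    (hC : 0 < ∫ y, f 0 y ^ α ∂ν) {h : ℕ} {w : Fin h → ℝ} (hw : ∀ i, 0 < w i) :
    limitMeasure ν α f h (upperTail w) = ENNReal.ofReal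
      (tailExponent ν α (fun i : Fin h => f ((i : ℤ) + 1)) w / ∫ y, f 0 y ^ α ∂ν) := by
  rw [limitMeasure, Measure.map_apply (hX.measurable_pointVector h) (measurableSet_upperTail w),
    Measure.smul_apply, smul_eq_mul, div_eq_inv_mul, ENNReal.ofReal_mul (by positivity),
    ← intensity_iUnion_exceedance (φ := fun i : Fin h => f ((i : ℤ) + 1)) hX.index_pos
      (fun i => hX.measurable _) (fun i => hX.nonneg _)
      (fun i => hX.memLp _) hw]
  congr 1
  refine measure_congr ?_
  filter_upwards [ae_intensity_pos] with p hp
  refine propext ?_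
  change (∃ i, w i < _) ↔ p ∈ ⋃ i : Fin h, exceedance α (f ((i : ℤ) + 1)) (w i)
  simp [exceedance, hp, pointVector]

/-- Dividing the vector of a point (g, y) by t replaces g by t^α g, so homogeneity is the scaling of
Lebesgue measure. -/
theorem limitMeasure_scale (hX : IsMaxStableProcess ν P α Γ Y f X) (h : ℕ) {t : ℝ} (ht : 0 < t)
    {D : Set (Fin h → ℝ)} (hD : MeasurableSet D) :
    limitMeasure ν α f h {x | t⁻¹ • x ∈ D}
      = ENNReal.ofReal (t ^ (-α)) * limitMeasure ν α f h D := by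
  have hm : MeasurableSet {x : Fin h → ℝ | t⁻¹ • x ∈ D} := hD.preimage (by fun_prop)
  have hpv := hX.measurable_pointVector h
  rw [limitMeasure, Measure.map_apply hpv hm, Measure.map_apply hpv hD, Measure.smul_apply,
    Measure.smul_apply, smul_eq_mul, smul_eq_mul, mul_left_comm, Real.rpow_neg ht.le,
    ← intensity_scale (Real.rpow_pos_of_pos ht α) (hpv hD)]
  congr 1
  refine measure_congr ?_
  filter_upwards [ae_intensity_pos] with p hp
  refine propext ?_
  change t⁻¹ • pointVector α f h p ∈ D ↔ pointVector α f h (t ^ α * p.1, p.2) ∈ D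
  have : t⁻¹ • pointVector α f h p = pointVector α f h (t ^ α * p.1, p.2) := by
    ext i
    simp only [pointVector, Pi.smul_apply, smul_eq_mul]
    rw [Real.mul_rpow (by positivity) hp.le, ← Real.rpow_mul ht.le, mul_neg, mul_one_div,
      div_self hX.index_pos.ne', Real.rpow_neg_one, mul_assoc]
  rw [this]

/-- The first coordinate, X_1, alone contributes positive mass; this makes the limit non-null for h
≥ 1. -/
theorem tailExponent_pos (hX : IsMaxStableProcess ν P α Γ Y f X) (hs : IsStrictlyStationary P X)
    (hC : 0 < ∫ y, f 0 y ^ α ∂ν) {h : ℕ} (hh : 1 ≤ h) {ε : ℝ} (hε : 0 < ε) :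
    0 < tailExponent ν α (fun i : Fin h => f ((i : ℤ) + 1)) fun _ => ε := by
  have h1 : 0 < ∫ y, (f 1 y / ε) ^ α ∂ν := by
    simp_rw [fun y => Real.div_rpow (hX.nonneg 1 y) hε.le α]
    rw [integral_div, hX.integral_rpow_eq hs 1]
    positivity
  refine h1.trans_le (integral_mono_of_nonneg (Eventually.of_forall fun y =>
    Real.rpow_nonneg (div_nonneg (hX.nonneg _ _) hε.le) _)
    (hX.integrable_iSup (fun i : Fin h => (i : ℤ) + 1) fun _ => hε)
    (Eventually.of_forall fun y => ?_))
  exact le_ciSup_of_le (Finite.bddAbove_range _) (⟨0, hh⟩ : Fin h) (by simp)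

theorem rescaledLaw_eq (hX : IsMaxStableProcess ν P α Γ Y f X) (h : ℕ) (n : ℕ) (s : ℝ) :
    (n : ℝ≥0∞) • rescaledLaw P (lagged X h) s
      = puncturedMeasure ((n : ℝ≥0∞) • P.map fun ω i => lagged X h ω i / s) := by
  have hm : Measurable fun ω (i : Fin h) => lagged X h ω i / s :=
    measurable_pi_lambda _ fun i => (hX.measurable_process _).div_const s
  rw [puncturedMeasure, Measure.map_smul, Measure.map_map measurable_toExtended hm,
    Measure.comap_smul]
  rfl

theorem isRegularlyVarying (hX : IsMaxStableProcess ν P α Γ Y f X)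
    (hs : IsStrictlyStationary P X) (hC : 0 < ∫ y, f 0 y ^ α ∂ν) :
    IsRegularlyVarying P X α fun h => puncturedMeasure (limitMeasure ν α f h) where
  exists_normalizing := hX.exists_isNormalizing hC
  isTailMeasure h hh :=
    { ne_zero := by
        intro h0
        have h1 := puncturedMeasure_compl_rectangle (hX.ae_limitMeasure_nonneg h)
          (w := fun _ => 1) fun _ => one_pos
        rw [h0, hX.limitMeasure_upperTail hC fun _ => one_pos] at h1
        have := div_pos (hX.tailExponent_pos hs hC hh one_pos) hC
        rw [Measure.coe_zero, Pi.zero_apply, eq_comm, ENNReal.ofReal_eq_zero] at h1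
        linarith
      radon := fun K hK => puncturedMeasure_compact_lt_top (hX.ae_limitMeasure_nonneg h)
        (fun w hw => by rw [hX.limitMeasure_upperTail hC hw]; exact ENNReal.ofReal_ne_top) hK
      homogeneous := fun t ht A hA =>
        puncturedMeasure_scale ht (fun D hD => hX.limitMeasure_scale h ht hD) hA
      infinite_null := puncturedMeasure_infinite }
  vague a ha h hh := by
    simp_rw [hX.rescaledLaw_eq]
    have hpos : ∀ᶠ n in atTop, 0 < a n := ha.1.eventually_gt_atTop 0
    have hm : ∀ n, Measurable fun ω (i : Fin h) => lagged X h ω i / a n := fun n =>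
      measurable_pi_lambda _ fun i => (hX.measurable_process _).div_const _
    refine vagueTendsto_puncturedMeasure ?_ (hX.ae_limitMeasure_nonneg h) ?_ ?_ ?_ ?_
    · filter_upwards [hpos] with n hn
      refine Measure.ae_smul_measure ?_ _
      have hms : MeasurableSet {x : Fin h → ℝ | ∀ i, 0 ≤ x i} := by
        simp only [ofPred_forall]
        exact MeasurableSet.iInter fun i =>
          _root_.measurableSet_le measurable_const (measurable_pi_apply i)
      rw [ae_map_iff (hm n).aemeasurable hms]
      exact Eventually.of_forall fun ω i => div_nonneg (hX.process_nonneg _ _) hn.le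
    · intro n w _
      rw [Measure.smul_apply, Measure.map_apply (hm n) (measurableSet_upperTail w), smul_eq_mul]
      exact ENNReal.mul_ne_top (ENNReal.natCast_ne_top n) (measure_ne_top _ _)
    · intro w hw
      rw [hX.limitMeasure_upperTail hC hw]
      exact ENNReal.ofReal_ne_top
    · intro ε hε
      rw [hX.limitMeasure_upperTail hC fun _ => hε, ENNReal.ofReal_ne_zero_iff]
      exact div_pos (hX.tailExponent_pos hs hC hh hε) hC
    · intro w hw
      have hV : 0 ≤ tailExponent ν α (fun i : Fin h => f ((i : ℤ) + 1)) w :=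
        tailExponent_nonneg (fun i => hX.nonneg _) hw
      have key := hX.tendsto_real_exists_lt tendsto_natCast_atTop_atTop hpos
        (hX.tendsto_of_isNormalizing hC ha) (fun i : Fin h => (i : ℤ) + 1) hw
      rw [measureReal_def (limitMeasure ν α f h), hX.limitMeasure_upperTail hC hw,
        ENNReal.toReal_ofReal (by positivity), div_eq_inv_mul]
      refine key.congr' ?_
      filter_upwards [hpos] with n hn
      rw [measureReal_def ((n : ℝ≥0∞) • _), Measure.smul_apply,
        Measure.map_apply (hm n) (measurableSet_upperTail w), smul_eq_mul, ENNReal.toReal_mul,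
        ENNReal.toReal_natCast, ← measureReal_def]
      congr 2
      ext ω
      simp only [upperTail, mem_preimage, mem_ofPred_eq, lagged]
      exact exists_congr fun i => by rw [lt_div_iff₀ hn, mul_comm]

end IsMaxStableProcess

/-! ### A covariance inequality for independent Bernoulli variables -/

/-- The expectation of `F(ε_1, …, ε_n)` for independent `ε_k` with `P(ε_k = true) = p_k`. -/
def bernoulliExp {n : ℕ} (p : Fin n → ℝ) (F : (Fin n → Bool) → ℝ) : ℝ :=
  ∑ e, (∏ k, if e k then p k else 1 - p k) * F e

section Bernoulli

variable {n : ℕ}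

/-- Conditioning on the first coordinate, the step of the inductions below. -/
theorem bernoulliExp_succ (p : Fin (n + 1) → ℝ) (F : (Fin (n + 1) → Bool) → ℝ) :
    bernoulliExp p F =
      (1 - p 0) * bernoulliExp (Fin.tail p) (fun e => F (Fin.cons false e))
        + p 0 * bernoulliExp (Fin.tail p) (fun e => F (Fin.cons true e)) := by
  simp only [bernoulliExp]
  rw [← (Fin.consEquiv fun _ : Fin (n + 1) => Bool).sum_comp, Fintype.sum_prod_type,
    Fintype.sum_bool, Finset.mul_sum, Finset.mul_sum, add_comm]
  simp [Fin.consEquiv, Fin.prod_univ_succ, Fin.tail, mul_assoc]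

theorem bernoulliExp_mono {p : Fin n → ℝ} (hp : ∀ k, 0 ≤ p k ∧ p k ≤ 1)
    {F G : (Fin n → Bool) → ℝ} (h : ∀ e, F e ≤ G e) : bernoulliExp p F ≤ bernoulliExp p G := by
  refine Finset.sum_le_sum fun e _ => mul_le_mul_of_nonneg_left (h e) ?_
  refine Finset.prod_nonneg fun k _ => ?_
  split_ifs
  · exact (hp k).1
  · linarith [(hp k).2]

theorem bernoulliExp_sub (p : Fin n → ℝ) (F G : (Fin n → Bool) → ℝ) :
    bernoulliExp p (fun e => F e - G e) = bernoulliExp p F - bernoulliExp p G := by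
  simp [bernoulliExp, mul_sub]

theorem bernoulliExp_sum {ι : Type*} (p : Fin n → ℝ) (s : Finset ι)
    (F : ι → (Fin n → Bool) → ℝ) :
    bernoulliExp p (fun e => ∑ i ∈ s, F i e) = ∑ i ∈ s, bernoulliExp p (F i) := by
  simp only [bernoulliExp, Finset.mul_sum]
  exact Finset.sum_comm

/-- Expectations of products of functions of single coordinates. -/
theorem bernoulliExp_prod (p : Fin n → ℝ) (φ : Fin n → Bool → ℝ) :
    bernoulliExp p (fun e => ∏ k, φ k (e k))
      = ∏ k, (p k * φ k true + (1 - p k) * φ k false) := by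
  induction n with
  | zero => simp [bernoulliExp]
  | succ n ih =>
    rw [bernoulliExp_succ, Fin.prod_univ_succ]
    have h : ∀ b, bernoulliExp (Fin.tail p) (fun e => ∏ k, φ k ((Fin.cons b e : Fin (n + 1) → Bool) k))
        = φ 0 b * ∏ k : Fin n, (p k.succ * φ k.succ true + (1 - p k.succ) * φ k.succ false) := by
      intro b
      have := ih (Fin.tail p) (fun k => φ k.succ)
      simp only [Fin.tail] at this
      rw [← this]
      simp only [bernoulliExp, Fin.prod_univ_succ, Fin.cons_zero, Fin.cons_succ, Fin.tail,
        Finset.mul_sum]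
      exact Finset.sum_congr rfl fun e _ => by ring
    rw [h, h]
    ring

theorem bernoulliExp_one (p : Fin n → ℝ) : bernoulliExp p (fun _ => 1) = 1 := by
  simpa using bernoulliExp_prod p fun _ _ => 1

theorem bernoulliExp_nonneg {p : Fin n → ℝ} (hp : ∀ k, 0 ≤ p k ∧ p k ≤ 1)
    {F : (Fin n → Bool) → ℝ} (h : ∀ e, 0 ≤ F e) : 0 ≤ bernoulliExp p F := by
  simpa [bernoulliExp] using bernoulliExp_mono hp h

theorem bernoulliExp_le_one {p : Fin n → ℝ} (hp : ∀ k, 0 ≤ p k ∧ p k ≤ 1)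
    {F : (Fin n → Bool) → ℝ} (h : ∀ e, F e ≤ 1) : bernoulliExp p F ≤ 1 :=
  (bernoulliExp_mono hp h).trans_eq (bernoulliExp_one p)

/-- Changing coordinate 0 gives the same difference whatever its present value, so the bound holds
on both sections of u. The convex combination of the two sectional bounds is the full expectation.
-/
theorem abs_bernoulliExp_cons_sub_le {ι : Type*} {p : Fin (n + 1) → ℝ}
    (hp : ∀ k, 0 ≤ p k ∧ p k ≤ 1) {s : Finset ι} {F : (Fin (n + 1) → Bool) → ℝ}
    {u : ι → (Fin (n + 1) → Bool) → ℝ}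
    (hF : ∀ e, |F (Function.update e 0 true) - F (Function.update e 0 false)| ≤ ∑ a ∈ s, u a e) :
    |bernoulliExp (Fin.tail p) (fun e => F (Fin.cons true e))
      - bernoulliExp (Fin.tail p) (fun e => F (Fin.cons false e))|
      ≤ ∑ a ∈ s, bernoulliExp p (u a) := by
  have hp' : ∀ k, 0 ≤ Fin.tail p k ∧ Fin.tail p k ≤ 1 := fun k => hp k.succ
  have hb : ∀ b : Bool, |bernoulliExp (Fin.tail p) (fun e => F (Fin.cons true e))
      - bernoulliExp (Fin.tail p) (fun e => F (Fin.cons false e))|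
        ≤ ∑ a ∈ s, bernoulliExp (Fin.tail p) (fun e => u a (Fin.cons b e)) := by
    intro b
    rw [← bernoulliExp_sub, ← bernoulliExp_sum]
    have h1 : ∀ e : Fin n → Bool, |F (Fin.cons true e) - F (Fin.cons false e)|
        ≤ ∑ a ∈ s, u a (Fin.cons b e) := by
      intro e
      simpa only [Fin.update_cons_zero] using hF (Fin.cons b e)
    refine abs_le.2 ⟨?_, bernoulliExp_mono hp' fun e => (abs_le.1 (h1 e)).2⟩
    have := bernoulliExp_mono hp' fun e => (abs_le.1 (h1 e)).1
    have hneg : bernoulliExp (Fin.tail p) (fun e => -∑ a ∈ s, u a (Fin.cons b e))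
        = -bernoulliExp (Fin.tail p) (fun e => ∑ a ∈ s, u a (Fin.cons b e)) := by
      simp [bernoulliExp]
    rwa [hneg] at this
  have h0 := mul_le_mul_of_nonneg_left (hb false) (sub_nonneg.2 (hp 0).2)
  have h1 := mul_le_mul_of_nonneg_left (hb true) (hp 0).1
  simp_rw [bernoulliExp_succ p (u _), Finset.sum_add_distrib, ← Finset.mul_sum]
  linarith

/-- On [0, 1] a product is at most the minimum of its factors. -/
theorem abs_sum_mul_sum_le_sum_min {ι ι' : Type*} {s : Finset ι} {t : Finset ι'} {u : ι → ℝ}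
    {v : ι' → ℝ} (hu : ∀ a, 0 ≤ u a ∧ u a ≤ 1) (hv : ∀ b, 0 ≤ v b ∧ v b ≤ 1) {x y : ℝ}
    (hx : |x| ≤ ∑ a ∈ s, u a) (hy : |y| ≤ ∑ b ∈ t, v b) :
    |x * y| ≤ ∑ a ∈ s, ∑ b ∈ t, min (u a) (v b) := by
  rw [abs_mul]
  refine (mul_le_mul hx hy (abs_nonneg _) ((abs_nonneg _).trans hx)).trans ?_
  rw [Finset.sum_mul_sum]
  refine Finset.sum_le_sum fun a _ => Finset.sum_le_sum fun b _ => le_min ?_ ?_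
  · exact mul_le_of_le_one_right (hu a).1 (hv b).2
  · exact mul_le_of_le_one_left (hv b).1 (hu a).2

/-- A covariance inequality for functions of independent Bernoulli variables, in terms of bounds
for the influences of the variables. -/
theorem abs_bernoulli_covariance_le {ι ι' : Type*} {s : Finset ι} {t : Finset ι'}
    {p : Fin n → ℝ} (hp : ∀ k, 0 ≤ p k ∧ p k ≤ 1) {F G : (Fin n → Bool) → ℝ}
    {u : ι → Fin n → (Fin n → Bool) → ℝ} {v : ι' → Fin n → (Fin n → Bool) → ℝ}
    (hu : ∀ a k e, 0 ≤ u a k e ∧ u a k e ≤ 1) (hv : ∀ b k e, 0 ≤ v b k e ∧ v b k e ≤ 1)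
    (hF : ∀ k e, |F (Function.update e k true) - F (Function.update e k false)|
      ≤ ∑ a ∈ s, u a k e)
    (hG : ∀ k e, |G (Function.update e k true) - G (Function.update e k false)|
      ≤ ∑ b ∈ t, v b k e) :
    |bernoulliExp p (fun e => F e * G e) - bernoulliExp p F * bernoulliExp p G|
      ≤ ∑ k, p k * (1 - p k) * ∑ a ∈ s, ∑ b ∈ t,
        min (bernoulliExp p (u a k)) (bernoulliExp p (v b k)) := by
  induction n with
  | zero => simp [bernoulliExp]
  | succ n ih =>
    have hp' : ∀ k, 0 ≤ Fin.tail p k ∧ Fin.tail p k ≤ 1 := fun k => hp k.succ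
    have hq : 0 ≤ 1 - p 0 := sub_nonneg.2 (hp 0).2
    have ihb : ∀ c : Bool, _ := fun c => ih hp' (F := fun e => F (Fin.cons c e))
      (G := fun e => G (Fin.cons c e)) (u := fun a k e => u a k.succ (Fin.cons c e))
      (v := fun b k e => v b k.succ (Fin.cons c e)) (fun a k e => hu a _ _) (fun b k e => hv b _ _)
      (fun k e => by simpa only [Fin.cons_update] using hF k.succ (Fin.cons c e))
      (fun k e => by simpa only [Fin.cons_update] using hG k.succ (Fin.cons c e))
    have hlast := abs_sum_mul_sum_le_sum_min (s := s) (t := t)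
      (u := fun a => bernoulliExp p (u a 0)) (v := fun b => bernoulliExp p (v b 0))
      (fun a => ⟨bernoulliExp_nonneg hp fun e => (hu a 0 e).1,
        bernoulliExp_le_one hp fun e => (hu a 0 e).2⟩)
      (fun b => ⟨bernoulliExp_nonneg hp fun e => (hv b 0 e).1,
        bernoulliExp_le_one hp fun e => (hv b 0 e).2⟩)
      (abs_bernoulliExp_cons_sub_le hp (hF 0)) (abs_bernoulliExp_cons_sub_le hp (hG 0))
    set F₁ := bernoulliExp (Fin.tail p) fun e => F (Fin.cons true e)
    set F₀ := bernoulliExp (Fin.tail p) fun e => F (Fin.cons false e)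
    set G₁ := bernoulliExp (Fin.tail p) fun e => G (Fin.cons true e)
    set G₀ := bernoulliExp (Fin.tail p) fun e => G (Fin.cons false e)
    set H₁ := bernoulliExp (Fin.tail p) fun e => F (Fin.cons true e) * G (Fin.cons true e)
    set H₀ := bernoulliExp (Fin.tail p) fun e => F (Fin.cons false e) * G (Fin.cons false e)
    -- Law of total covariance: the mean of the conditional covariances plus the covariance of the
    -- conditional means.
    have hsplit : bernoulliExp p (fun e => F e * G e) - bernoulliExp p F * bernoulliExp p G
        = (1 - p 0) * (H₀ - F₀ * G₀) + p 0 * (H₁ - F₁ * G₁)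
          + p 0 * (1 - p 0) * ((F₁ - F₀) * (G₁ - G₀)) := by
      rw [bernoulliExp_succ p F, bernoulliExp_succ p G, bernoulliExp_succ]
      ring
    -- Concavity of the minimum: averaging the sectional minima gives at most the minimum of the
    -- averages.
    have hmin : ∀ k : Fin n, ∀ a b,
        (1 - p 0) * min (bernoulliExp (Fin.tail p) fun e => u a k.succ (Fin.cons false e))
            (bernoulliExp (Fin.tail p) fun e => v b k.succ (Fin.cons false e))
          + p 0 * min (bernoulliExp (Fin.tail p) fun e => u a k.succ (Fin.cons true e))
            (bernoulliExp (Fin.tail p) fun e => v b k.succ (Fin.cons true e))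
          ≤ min (bernoulliExp p (u a k.succ)) (bernoulliExp p (v b k.succ)) := by
      intro k a b
      rw [bernoulliExp_succ p (u a k.succ), bernoulliExp_succ p (v b k.succ)]
      refine le_min ?_ ?_
      · exact add_le_add (mul_le_mul_of_nonneg_left (min_le_left _ _) hq)
          (mul_le_mul_of_nonneg_left (min_le_left _ _) (hp 0).1)
      · exact add_le_add (mul_le_mul_of_nonneg_left (min_le_right _ _) hq)
          (mul_le_mul_of_nonneg_left (min_le_right _ _) (hp 0).1)
    rw [hsplit, Fin.sum_univ_succ]
    have h3 : |p 0 * (1 - p 0) * ((F₁ - F₀) * (G₁ - G₀))| ≤ p 0 * (1 - p 0) *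
        ∑ a ∈ s, ∑ b ∈ t, min (bernoulliExp p (u a 0)) (bernoulliExp p (v b 0)) := by
      rw [abs_mul, abs_of_nonneg (mul_nonneg (hp 0).1 hq)]
      exact mul_le_mul_of_nonneg_left hlast (mul_nonneg (hp 0).1 hq)
    have h12 : |(1 - p 0) * (H₀ - F₀ * G₀) + p 0 * (H₁ - F₁ * G₁)| ≤
        ∑ k : Fin n, p k.succ * (1 - p k.succ) * ∑ a ∈ s, ∑ b ∈ t,
          min (bernoulliExp p (u a k.succ)) (bernoulliExp p (v b k.succ)) := by
      refine (abs_add_le _ _).trans ?_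
      rw [abs_mul, abs_mul, abs_of_nonneg hq, abs_of_nonneg (hp 0).1]
      refine (add_le_add (mul_le_mul_of_nonneg_left (ihb false) hq)
        (mul_le_mul_of_nonneg_left (ihb true) (hp 0).1)).trans ?_
      rw [Finset.mul_sum, Finset.mul_sum, ← Finset.sum_add_distrib]
      refine Finset.sum_le_sum fun k _ => ?_
      rw [mul_left_comm, mul_left_comm (p 0), ← mul_add]
      refine mul_le_mul_of_nonneg_left ?_
        (mul_nonneg (hp k.succ).1 (sub_nonneg.2 (hp k.succ).2))
      simp_rw [Finset.mul_sum, ← Finset.sum_add_distrib]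
      exact Finset.sum_le_sum fun a _ => Finset.sum_le_sum fun b _ => hmin k a b
    rw [add_comm (p 0 * (1 - p 0) * _)]
    exact (abs_add_le _ _).trans (add_le_add h12 h3)

/-- Functions of independent `Bool`-valued random variables. -/
theorem integral_eq_bernoulliExp {Ω : Type*} [MeasurableSpace Ω] {P : Measure Ω}
    [IsProbabilityMeasure P] {ε : Fin n → Ω → Bool} (hm : ∀ k, Measurable (ε k))
    (hind : iIndepFun ε P) {p : Fin n → ℝ} (hp : ∀ k, P.real {ω | ε k ω = true} = p k)
    (F : (Fin n → Bool) → ℝ) :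
    ∫ ω, F (fun k => ε k ω) ∂P = bernoulliExp p F := by
  have hvec : Measurable fun ω k => ε k ω := measurable_pi_lambda _ hm
  have h1 := integral_map (μ := P) hvec.aemeasurable (f := F)
    (measurable_of_finite F).aestronglyMeasurable
  have : IsProbabilityMeasure (P.map fun ω k => ε k ω) :=
    Measure.isProbabilityMeasure_map hvec.aemeasurable
  rw [← h1, integral_fintype .of_finite, bernoulliExp]
  refine Finset.sum_congr rfl fun e _ => ?_
  rw [smul_eq_mul, map_measureReal_apply hvec (measurableSet_singleton e)]
  congr 1
  have h2 := hind.measure_inter_preimage_eq_mul Finset.univ (sets := fun k => {e k})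
    fun k _ => measurableSet_singleton _
  have h3 : (fun ω k => ε k ω) ⁻¹' {e} = ⋂ k ∈ Finset.univ, ε k ⁻¹' {e k} := by
    ext ω
    simp [funext_iff]
  rw [h3, measureReal_def, h2, ENNReal.toReal_prod]
  refine Finset.prod_congr rfl fun k _ => ?_
  rw [← measureReal_def]
  have hset : MeasurableSet {ω | ε k ω = true} := hm k (measurableSet_singleton true)
  cases hk : e k
  · have : ε k ⁻¹' {false} = {ω | ε k ω = true}ᶜ := by
      ext ω; simp
    rw [this, probReal_compl_eq_one_sub hset, hp]
    simp
  · rw [if_pos rfl, ← hp]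
    rfl

end Bernoulli

/-! ### Cells, occupation and influence -/

/-- The event `A` is determined by the events `{X_t ≤ x}`, `(t, x) ∈ D`. -/
def IsDeterminedBy {Ω : Type*} (X : ℤ → Ω → ℝ) (D : Finset (ℤ × ℝ)) (A : Set Ω) : Prop :=
  ∀ ω ω', (∀ d ∈ D, X d.1 ω ≤ d.2 ↔ X d.1 ω' ≤ d.2) → (ω ∈ A ↔ ω' ∈ A)

section Cells

variable {E : Type*} [MeasurableSpace E]

open Classical in
/-- The elements `(t, x)` of `D` such that the point `(g, y)` satisfies `g ^ (-1/α) f_t(y) > x`. -/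
noncomputable def cellLabel (α : ℝ) (f : ℤ → E → ℝ) (D : Finset (ℤ × ℝ)) (p : ℝ × E) :
    Finset (ℤ × ℝ) :=
  D.filter fun d => p ∈ exceedance α (f d.1) d.2

theorem mem_cellLabel {α : ℝ} {f : ℤ → E → ℝ} {D : Finset (ℤ × ℝ)} {p : ℝ × E} {d : ℤ × ℝ} :
    d ∈ cellLabel α f D p ↔ d ∈ D ∧ p ∈ exceedance α (f d.1) d.2 := by
  simp [cellLabel]

theorem measurableSet_cell (α : ℝ) {f : ℤ → E → ℝ} (hf : ∀ t, Measurable (f t))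
    {D c : Finset (ℤ × ℝ)} (hc : c ⊆ D) : MeasurableSet {p | cellLabel α f D p = c} := by
  have : {p | cellLabel α f D p = c} =
      ⋂ d ∈ D, {p | p ∈ exceedance α (f d.1) d.2 ↔ d ∈ c} := by
    ext p
    simp only [mem_ofPred_eq, mem_iInter, Finset.ext_iff, mem_cellLabel]
    constructor
    · intro h d hd
      simpa [hd] using h d
    · intro h d
      by_cases hd : d ∈ D
      · simpa [hd] using h d hd
      · simpa [hd] using fun hdc => hd (hc hdc)
  rw [this]
  refine Finset.measurableSet_biInter _ fun d _ => ?_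
  by_cases hd : d ∈ c
  · simpa [hd] using measurableSet_exceedance α (hf d.1) d.2
  · have : {p | p ∈ exceedance α (f d.1) d.2 ↔ d ∈ c} = (exceedance α (f d.1) d.2)ᶜ := by
      ext p; simp [hd]
    rw [this]
    exact (measurableSet_exceedance α (hf d.1) d.2).compl

/-- An enumeration of the labels of the nonempty cells other than the unbounded one. -/
theorem exists_cell_enumeration (α : ℝ) (f : ℤ → E → ℝ) (D : Finset (ℤ × ℝ)) :
    ∃ (n : ℕ) (c : Fin n → Finset (ℤ × ℝ)), Function.Injective c ∧ (∀ k, c k ⊆ D) ∧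
      (∀ k, (c k).Nonempty) ∧ (∀ k, ∃ p, cellLabel α f D p = c k) ∧
      ∀ p, (cellLabel α f D p).Nonempty → ∃ k, c k = cellLabel α f D p := by
  classical
  set S := D.powerset.filter fun c => c.Nonempty ∧ ∃ p, cellLabel α f D p = c with hS
  have hmem : ∀ k : Fin S.card, (S.equivFin.symm k).1 ⊆ D ∧ (S.equivFin.symm k).1.Nonempty ∧
      ∃ p, cellLabel α f D p = (S.equivFin.symm k).1 := by
    intro k
    simpa [hS] using (S.equivFin.symm k).2
  refine ⟨S.card, fun k => (S.equivFin.symm k).1,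
    Subtype.val_injective.comp S.equivFin.symm.injective, fun k => (hmem k).1,
    fun k => (hmem k).2.1, fun k => (hmem k).2.2, fun p hp => ?_⟩
  have : cellLabel α f D p ∈ S := by
    simp only [hS, Finset.mem_filter, Finset.mem_powerset]
    exact ⟨Finset.filter_subset _ _, hp, p, rfl⟩
  exact ⟨S.equivFin ⟨_, this⟩, by simp⟩

end Cells

section Influence

variable {Ω : Type*} {n : ℕ}

open Classical in
/-- The indicator of the event that the occupation of cell `k` matters for the values at time `t`,
where `c k'` are the labels of the cells. -/
noncomputable def influence (D : Finset (ℤ × ℝ)) (c : Fin n → Finset (ℤ × ℝ)) (t : ℤ) (k : Fin n)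
    (e : Fin n → Bool) : ℝ :=
  if ∃ x, (t, x) ∈ D ∧ (t, x) ∈ c k ∧ ∀ k', k' ≠ k → (t, x) ∈ c k' → e k' = false then 1 else 0

theorem influence_mem (D : Finset (ℤ × ℝ)) (c : Fin n → Finset (ℤ × ℝ)) (t : ℤ) (k : Fin n)
    (e : Fin n → Bool) : 0 ≤ influence D c t k e ∧ influence D c t k e ≤ 1 := by
  unfold influence
  split_ifs <;> norm_num

open Classical in
/-- The indicator of an event `A` determined by `D` as a function of the occupied cells. -/
noncomputable def occupationIndicator (X : ℤ → Ω → ℝ) (D : Finset (ℤ × ℝ))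
    (c : Fin n → Finset (ℤ × ℝ)) (A : Set Ω) (e : Fin n → Bool) : ℝ :=
  if ∃ ω ∈ A, ∀ d ∈ D, X d.1 ω ≤ d.2 ↔ ∀ k, d ∈ c k → e k = false then 1 else 0

/-- Any outcome compatible with e may serve as representative, because a determined event does not
distinguish outcomes with the same threshold pattern. -/
theorem occupationIndicator_eq_indicator {X : ℤ → Ω → ℝ} {D : Finset (ℤ × ℝ)}
    {c : Fin n → Finset (ℤ × ℝ)} {A : Set Ω} (hA : IsDeterminedBy X D A) {e : Fin n → Bool} {ω : Ω}
    (h : ∀ d ∈ D, X d.1 ω ≤ d.2 ↔ ∀ k, d ∈ c k → e k = false) :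
    occupationIndicator X D c A e = A.indicator 1 ω := by
  classical
  unfold occupationIndicator
  by_cases hω : ω ∈ A
  · rw [if_pos ⟨ω, hω, h⟩, indicator_of_mem hω, Pi.one_apply]
  · rw [indicator_of_notMem hω, if_neg]
    rintro ⟨ω', hω', h'⟩
    exact hω ((hA ω ω' fun d hd => (h d hd).trans (h' d hd).symm).2 hω')

/-- Two indicators differ by at most 1, and they differ only if flipping cell k switches the status
of some threshold d ∈ D. Then d lies in the label of k and in no other occupied label, so the
influence at the time of d equals 1. -/
theorem abs_occupationIndicator_sub_le (X : ℤ → Ω → ℝ) (D : Finset (ℤ × ℝ))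
    (c : Fin n → Finset (ℤ × ℝ)) (A : Set Ω) (k : Fin n) (e : Fin n → Bool) :
    |occupationIndicator X D c A (Function.update e k true)
      - occupationIndicator X D c A (Function.update e k false)|
      ≤ ∑ t ∈ D.image Prod.fst, influence D c t k e := by
  classical
  have hsum : 0 ≤ ∑ t ∈ D.image Prod.fst, influence D c t k e :=
    Finset.sum_nonneg fun t _ => (influence_mem D c t k e).1
  by_cases hall : ∀ d ∈ D, (∀ k', d ∈ c k' → Function.update e k true k' = false) ↔
      ∀ k', d ∈ c k' → Function.update e k false k' = false
  · have : occupationIndicator X D c A (Function.update e k true)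
        = occupationIndicator X D c A (Function.update e k false) := by
      unfold occupationIndicator
      refine if_congr (exists_congr fun ω => and_congr_right fun _ => forall₂_congr fun d hd => ?_)
        rfl rfl
      rw [hall d hd]
    rwa [this, sub_self, abs_zero]
  · push Not at hall
    obtain ⟨d, hd, hne⟩ := hall
    have key : d ∈ c k ∧ ∀ k', k' ≠ k → d ∈ c k' → e k' = false := by
      rcases hne with ⟨h1, k', hk', h2⟩ | ⟨⟨k', hk', h1⟩, h2⟩
      · exfalso
        rcases eq_or_ne k' k with rfl | hkk
        · simp at h2
        · have := h1 k' hk'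
          rw [Function.update_of_ne hkk] at this h2
          exact h2 this
      · have hk : k' = k := by
          by_contra hkk
          have := h2 k' hk'
          rw [Function.update_of_ne hkk] at this h1
          exact h1 this
        refine ⟨hk ▸ hk', fun j hj hdj => ?_⟩
        have := h2 j hdj
        rwa [Function.update_of_ne hj] at this
    have hone : influence D c d.1 k e = 1 := if_pos ⟨d.2, hd, key⟩
    have h1 : |occupationIndicator X D c A (Function.update e k true)
        - occupationIndicator X D c A (Function.update e k false)| ≤ 1 := by
      unfold occupationIndicator
      split_ifs <;> simp
    refine h1.trans ?_
    rw [← hone]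
    exact Finset.single_le_sum (f := fun t => influence D c t k e)
      (fun t _ => (influence_mem D c t k e).1) (Finset.mem_image_of_mem _ hd)

end Influence

/-! ### The mixing bound for finitely many thresholds -/

/-- A bound for the probability that the point `(g, y)` is visible in `φ`- and `ψ`-integrals. -/
noncomputable def pairWeight {E : Type*} (C α : ℝ) (φ ψ : E → ℝ) (p : ℝ × E) : ℝ :=
  -- The value 0 is imposed here: division by zero would make the exponential equal to 1, which is
  -- not integrable in g over the half-line.
  if min (φ p.2 ^ α) (ψ p.2 ^ α) = 0 then 0
  else Real.exp (-(C / min (φ p.2 ^ α) (ψ p.2 ^ α)) * p.1)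

theorem measurable_pairWeight {E : Type*} [MeasurableSpace E] (C α : ℝ) {φ ψ : E → ℝ}
    (hφ : Measurable φ) (hψ : Measurable ψ) : Measurable (pairWeight C α φ ψ) := by
  have hm : Measurable fun p : ℝ × E => min (φ p.2 ^ α) (ψ p.2 ^ α) :=
    ((hφ.comp measurable_snd).pow_const _).min ((hψ.comp measurable_snd).pow_const _)
  refine Measurable.ite (hm (measurableSet_singleton 0)) measurable_const ?_
  exact Real.measurable_exp.comp (((measurable_const.div hm).neg).mul measurable_fst)

/-- For fixed y with minimum m > 0, the integral of exp(-C g / m) over g > 0 is m / C. -/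
theorem lintegral_pairWeight {E : Type*} [MeasurableSpace E] {ν : Measure E} [SigmaFinite ν]
    {C α : ℝ} (hC : 0 < C) {φ ψ : E → ℝ} (hφ : Measurable φ) (hψ : Measurable ψ)
    (hφ0 : ∀ y, 0 ≤ φ y) (hψ0 : ∀ y, 0 ≤ ψ y) :
    ∫⁻ p, ENNReal.ofReal (pairWeight C α φ ψ p) ∂(intensity ν)
      = ∫⁻ y, ENNReal.ofReal (min (φ y ^ α) (ψ y ^ α) / C) ∂ν := by
  rw [intensity, lintegral_prod_symm _
    (measurable_pairWeight C α hφ hψ).ennreal_ofReal.aemeasurable]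
  refine lintegral_congr fun y => ?_
  have h0 : 0 ≤ min (φ y ^ α) (ψ y ^ α) :=
    le_min (Real.rpow_nonneg (hφ0 y) _) (Real.rpow_nonneg (hψ0 y) _)
  rcases h0.eq_or_lt with h | h
  · simp [pairWeight, ← h]
  · simp only [pairWeight, h.ne', if_false]
    have hneg : -(C / min (φ y ^ α) (ψ y ^ α)) < 0 := neg_lt_zero.2 (by positivity)
    rw [← ofReal_integral_eq_lintegral_ofReal (integrableOn_exp_mul_Ioi hneg 0)
      (Eventually.of_forall fun _ => Real.exp_nonneg _), integral_exp_mul_Ioi hneg]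
    congr 1
    simp

namespace IsMaxStableProcess

variable {E Ω : Type*} [MeasurableSpace E] [MeasurableSpace Ω] {ν : Measure E} [SigmaFinite ν]
  {P : Measure Ω} [IsProbabilityMeasure P] {α : ℝ} {Γ : ℕ → Ω → ℝ} {Y : ℕ → Ω → E}
  {f : ℤ → E → ℝ} {X : ℤ → Ω → ℝ}

open Classical in
/-- The occupation indicators of disjoint sets are independent. -/
theorem _root_.MaxStable.IsPoissonPoints.iIndepFun_occupied (h : IsPoissonPoints P ν Γ Y) {n : ℕ}
    {S : Fin n → Set (ℝ × E)} (hS : ∀ k, MeasurableSet (S k))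
    (hd : Pairwise fun j k => Disjoint (S j) (S k)) :
    iIndepFun (fun k ω => decide (∃ i, (Γ i ω, Y i ω) ∈ S k)) P := by
  have h1 := (h.indep_count n S hS hd).comp (fun _ x => decide (x ≠ 0)) fun _ =>
    measurable_to_bool (by
      convert! (measurableSet_singleton (0 : ℝ≥0∞)).compl using 1
      ext; simp)
  convert! h1 using 3 with k ω
  rw [Function.comp_apply, decide_eq_decide, ne_eq, pointMeasure_eq_zero_iff ω (hS k)]
  simp

open Classical in
theorem _root_.MaxStable.IsPoissonPoints.measurable_occupied (h : IsPoissonPoints P ν Γ Y)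
    {S : Set (ℝ × E)} (hS : MeasurableSet S) :
    Measurable fun ω => decide (∃ i, (Γ i ω, Y i ω) ∈ S) := by
  refine measurable_to_bool ?_
  have : (fun ω => decide (∃ i, (Γ i ω, Y i ω) ∈ S)) ⁻¹' {true}
      = ⋃ i, (fun ω => (Γ i ω, Y i ω)) ⁻¹' S := by
    ext; simp
  rw [this]
  exact MeasurableSet.iUnion fun i => h.measurable_pair i hS

open Classical in
theorem _root_.MaxStable.IsPoissonPoints.real_occupied (h : IsPoissonPoints P ν Γ Y)
    {S : Set (ℝ × E)} (hS : MeasurableSet S) (hfin : intensity ν S ≠ ∞) :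
    P.real {ω | decide (∃ i, (Γ i ω, Y i ω) ∈ S) = true}
      = 1 - Real.exp (-(intensity ν S).toReal) := by
  rw [← h.real_avoid hS hfin, ← probReal_compl_eq_one_sub]
  · congr 1
    ext; simp
  · simp only [ofPred_forall]
    exact MeasurableSet.iInter fun i => (h.measurable_pair i hS).compl

/-- The void probability attached to the influence of a cell. -/
theorem influence_bound (hX : IsMaxStableProcess ν P α Γ Y f X) {n : ℕ}
    {D D' : Finset (ℤ × ℝ)} (hD : ∀ d ∈ D, 0 < d.2) (hD' : D' ⊆ D)
    {c : Fin n → Finset (ℤ × ℝ)} (hinj : Function.Injective c) (hsub : ∀ k, c k ⊆ D)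
    (hcell : ∀ k, ∃ p, cellLabel α f D p = c k)
    (hcover : ∀ p, (cellLabel α f D p).Nonempty → ∃ k, c k = cellLabel α f D p)
    (t : ℤ) (k : Fin n) {q : Fin n → ℝ}
    (hq : ∀ j, q j = 1 - Real.exp (-(intensity ν {p | cellLabel α f D p = c j}).toReal)) :
    bernoulliExp q (influence D' c t k) = 0 ∨
      ∃ ξ, 0 < ξ ∧ {p | cellLabel α f D p = c k} ⊆ exceedance α (f t) ξ ∧
        (1 - q k) * bernoulliExp q (influence D' c t k)
          ≤ Real.exp (-(ξ ^ (-α) * ∫ y, f t y ^ α ∂ν)) := by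
  classical
  have hq01 : ∀ j, 0 ≤ q j ∧ q j ≤ 1 := by
    intro j
    rw [hq j]
    exact ⟨sub_nonneg.2 (Real.exp_le_one_iff.2 (by simp)), by simp [Real.exp_nonneg]⟩
  by_cases hex : ∃ x, (t, x) ∈ D' ∧ (t, x) ∈ c k
  swap
  · left
    have : influence D' c t k = fun _ => 0 := by
      ext e
      exact if_neg fun ⟨x, h1, h2, _⟩ => hex ⟨x, h1, h2⟩
    simp [this, bernoulliExp]
  right
  have hfin : {x | (t, x) ∈ D' ∧ (t, x) ∈ c k}.Finite := by
    refine ((D'.image Prod.snd).finite_toSet).subset fun x hx => ?_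
    exact Finset.mem_coe.2 (Finset.mem_image.2 ⟨(t, x), hx.1, rfl⟩)
  -- The highest threshold at time t exceeded on cell k. Its exceedance region is the smallest among
  -- those thresholds, so it is void of other occupied cells whenever any of them is.
  obtain ⟨ξ, ⟨hξD', hξc⟩, hmax⟩ := hfin.exists_maximal hex
  have hξD := hD' hξD'
  have hξ : 0 < ξ := hD _ hξD
  have hexc : {p | cellLabel α f D p = c k} ⊆ exceedance α (f t) ξ := by
    intro p hp
    have : (t, ξ) ∈ cellLabel α f D p := by rw [hp]; exact hξc
    exact (mem_cellLabel.1 this).2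
  refine ⟨ξ, hξ, hexc, ?_⟩
  set H : Fin n → Prop := fun j => j ≠ k ∧ (t, ξ) ∈ c j with hH
  -- only the cells above the largest threshold below cell `k` matter
  have hle : ∀ e, influence D' c t k e
      ≤ ∏ j, (if H j then (if e j then (0 : ℝ) else 1) else 1) := by
    intro e
    have hnn : 0 ≤ ∏ j, (if H j then (if e j then (0 : ℝ) else 1) else 1) :=
      Finset.prod_nonneg fun j _ => by split_ifs <;> norm_num
    unfold influence
    split_ifs with hx
    · obtain ⟨x, hxD', hxc, hx⟩ := hx
      have hxξ : x ≤ ξ := by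
        by_contra! hlt
        exact absurd (hmax ⟨hxD', hxc⟩ hlt.le) (not_le.2 hlt)
      refine (Finset.prod_eq_one fun j _ => ?_).ge
      by_cases hj : H j
      -- The label `c j` belongs to an actual point, so exceeding ξ at time t entails exceeding the
      -- lower threshold x.
      · have hxj : (t, x) ∈ c j := by
          obtain ⟨p, hp⟩ := hcell j
          have h1 := hj.2
          rw [← hp, mem_cellLabel] at h1 ⊢
          exact ⟨hD' hxD', h1.2.1, hxξ.trans_lt h1.2.2⟩
        simp [hj, hx j hj.1 hxj]
      · simp [hj]
    · exact hnn
  have h1 := bernoulliExp_mono hq01 hle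
  have h2 := bernoulliExp_prod q fun j b => if H j then (if b then (0 : ℝ) else 1) else 1
  rw [h2] at h1
  set m : Fin n → ℝ≥0∞ := fun j => intensity ν {p | cellLabel α f D p = c j} with hm
  have hprod : ∏ j, (q j * (if H j then (if true then (0 : ℝ) else 1) else 1)
      + (1 - q j) * (if H j then (if false then (0 : ℝ) else 1) else 1))
      = ∏ j ∈ Finset.univ.filter H, Real.exp (-(m j).toReal) := by
    rw [Finset.prod_filter]
    refine Finset.prod_congr rfl fun j _ => ?_
    by_cases hj : H j
    · rw [if_pos hj, if_pos hj, if_pos hj, hq j]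
      simp [hm]
    · rw [if_neg hj, if_neg hj, if_neg hj]
      ring
  -- The influence ignores the state of cell k itself; the factor 1 - q k supplies its void
  -- probability and completes the region above ξ.
  have hk : 1 - q k = Real.exp (-(m k).toReal) := by rw [hq k]; ring
  have hknot : k ∉ Finset.univ.filter H := by simp [hH]
  have hins : Real.exp (-(m k).toReal) * ∏ j ∈ Finset.univ.filter H, Real.exp (-(m j).toReal)
      = Real.exp (-∑ j ∈ insert k (Finset.univ.filter H), (m j).toReal) := by
    rw [← Finset.prod_insert (f := fun j => Real.exp (-(m j).toReal)) hknot, ← Real.exp_sum,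
      Finset.sum_neg_distrib]
  have hmeas : ∀ j, MeasurableSet {p | cellLabel α f D p = c j} := fun j =>
    measurableSet_cell α hX.measurable (hsub j)
  -- the cells above `ξ` at time `t` partition the exceedance set
  have hpart : exceedance α (f t) ξ
      = ⋃ j ∈ insert k (Finset.univ.filter H), {p | cellLabel α f D p = c j} := by
    ext p
    simp only [Finset.mem_insert, Finset.mem_filter, Finset.mem_univ, true_and, mem_iUnion,
      mem_ofPred_eq, exists_prop, hH]
    constructor
    · intro hp
      have hmem : (t, ξ) ∈ cellLabel α f D p := mem_cellLabel.2 ⟨hξD, hp⟩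
      obtain ⟨j, hj⟩ := hcover p ⟨_, hmem⟩
      refine ⟨j, ?_, hj.symm⟩
      by_cases hjk : j = k
      · exact Or.inl hjk
      · exact Or.inr ⟨hjk, hj ▸ hmem⟩
    · rintro ⟨j, hj, hp⟩
      have hmem : (t, ξ) ∈ c j := by
        rcases hj with rfl | hj
        · exact hξc
        · exact hj.2
      rw [← hp] at hmem
      exact (mem_cellLabel.1 hmem).2
  have hint := hX.intensity_exceedance t hξ
  rw [hpart, measure_biUnion_finset (fun i _ j _ hij => by
    rw [Function.onFun, Set.disjoint_left]
    intro p (hp : _ = c i) (hp' : _ = c j)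
    exact hij (hinj (hp.symm.trans hp'))) fun j _ => hmeas j] at hint
  have hC0 : 0 ≤ ∫ y, f t y ^ α ∂ν := integral_nonneg fun y => Real.rpow_nonneg (hX.nonneg t y) _
  have hreal : ∑ j ∈ insert k (Finset.univ.filter H), (m j).toReal
      = ξ ^ (-α) * ∫ y, f t y ^ α ∂ν := by
    rw [← ENNReal.toReal_ofReal (mul_nonneg (Real.rpow_nonneg hξ.le (-α)) hC0), ← hint,
      ENNReal.toReal_sum]
    intro j hj
    have := (ENNReal.sum_eq_top (s := insert k (Finset.univ.filter H)) (f := m)).not.1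
      (by rw [hm]; dsimp only; rw [hint]; exact ENNReal.ofReal_ne_top)
    exact fun h => this ⟨j, hj, h⟩
  rw [← hreal, ← hins, ← hprod, hk]
  exact mul_le_mul_of_nonneg_left h1 (Real.exp_nonneg _)

/-- Membership reads g ξ^α < f_t(y)^α, that is g / f_t(y)^α < ξ^{-α}. This trades the threshold of a
cell for a function of its points, ready to be integrated. -/
theorem exp_le_of_mem_exceedance (hX : IsMaxStableProcess ν P α Γ Y f X) {t : ℤ} {ξ C : ℝ}
    (hC : 0 ≤ C) (hξ : 0 < ξ) {p : ℝ × E} (hp : p ∈ exceedance α (f t) ξ) :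
    0 < f t p.2 ^ α ∧ Real.exp (-(ξ ^ (-α) * C)) ≤ Real.exp (-(C / f t p.2 ^ α) * p.1) := by
  obtain ⟨h0, h1⟩ := (mem_exceedance_iff hX.index_pos hξ (hX.nonneg t) p).1 hp
  rw [Real.div_rpow (hX.nonneg t _) hξ.le] at h1
  have hξα : 0 < ξ ^ α := Real.rpow_pos_of_pos hξ α
  have hpos : 0 < f t p.2 ^ α := by
    by_contra! hn
    exact absurd (h0.trans h1) (not_lt.2 (div_nonpos_of_nonpos_of_nonneg hn hξα.le))
  refine ⟨hpos, Real.exp_le_exp.2 ?_⟩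
  rw [neg_mul, neg_le_neg_iff, Real.rpow_neg hξ.le, div_mul_eq_mul_div, div_le_iff₀ hpos,
    inv_mul_eq_div, div_mul_eq_mul_div, le_div_iff₀ hξα, mul_assoc]
  refine mul_le_mul_of_nonneg_left ?_ hC
  exact ((lt_div_iff₀ hξα).1 h1).le

/-- The occupation probability 1 - e^{-m} is at most the intensity m of the cell, and r bounds the
weight from below at each of its points. -/
theorem ofReal_cell_le (hX : IsMaxStableProcess ν P α Γ Y f X) {S : Set (ℝ × E)}
    (hS : MeasurableSet S) {s t : ℤ} {ξ η C : ℝ} (hC : 0 ≤ C) (hξ : 0 < ξ) (hη : 0 < η)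
    (hs : S ⊆ exceedance α (f s) ξ) (ht : S ⊆ exceedance α (f t) η)
    {q r : ℝ} (hq : q = 1 - Real.exp (-(intensity ν S).toReal))
    (hr : r ≤ min (Real.exp (-(ξ ^ (-α) * C))) (Real.exp (-(η ^ (-α) * C)))) :
    ENNReal.ofReal (q * r)
      ≤ ∫⁻ p in S, ENNReal.ofReal (pairWeight C α (f s) (f t) p) ∂(intensity ν) := by
  have hq0 : 0 ≤ q := by
    rw [hq]
    exact sub_nonneg.2 (Real.exp_le_one_iff.2 (by simp))
  have hqm : q ≤ (intensity ν S).toReal := by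
    rw [hq]
    linarith [Real.add_one_le_exp (-(intensity ν S).toReal)]
  have h1 : ENNReal.ofReal (q * r) ≤ ∫⁻ _ in S, ENNReal.ofReal r ∂(intensity ν) := by
    rw [setLIntegral_const, ENNReal.ofReal_mul hq0, mul_comm]
    refine mul_le_mul_right ?_ _
    exact ENNReal.ofReal_le_of_le_toReal hqm
  refine h1.trans (setLIntegral_mono' hS fun p hp => ENNReal.ofReal_le_ofReal ?_)
  obtain ⟨hs0, hs1⟩ := hX.exp_le_of_mem_exceedance hC hξ (hs hp)
  obtain ⟨ht0, ht1⟩ := hX.exp_le_of_mem_exceedance hC hη (ht hp)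
  rw [pairWeight, if_neg (lt_min hs0 ht0).ne']
  rcases min_choice (f s p.2 ^ α) (f t p.2 ^ α) with e | e <;> rw [e]
  · exact (hr.trans (min_le_left _ _)).trans hs1
  · exact (hr.trans (min_le_right _ _)).trans ht1

/-- The mixing bound for events that depend on finitely many threshold exceedances. -/
theorem abs_real_inter_sub_le (hX : IsMaxStableProcess ν P α Γ Y f X)
    (hs : IsStrictlyStationary P X) (hC : 0 < ∫ y, f 0 y ^ α ∂ν) {D₁ D₂ : Finset (ℤ × ℝ)}
    (hD₁ : ∀ d ∈ D₁, 0 < d.2) (hD₂ : ∀ d ∈ D₂, 0 < d.2) {A B : Set Ω}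
    (hA : MeasurableSet A) (hB : MeasurableSet B) (hAD : IsDeterminedBy X D₁ A)
    (hBD : IsDeterminedBy X D₂ B) :
    |P.real (A ∩ B) - P.real A * P.real B| ≤
      ∑ s ∈ D₁.image Prod.fst, ∑ t ∈ D₂.image Prod.fst,
        (∫ y, min (f s y ^ α) (f t y ^ α) ∂ν) / ∫ y, f 0 y ^ α ∂ν := by
  classical
  set C := ∫ y, f 0 y ^ α ∂ν with hCdef
  set D := D₁ ∪ D₂ with hDdef
  have hD : ∀ d ∈ D, 0 < d.2 := fun d hd =>
    (Finset.mem_union.1 hd).elim (hD₁ d) (hD₂ d)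
  obtain ⟨n, c, hinj, hsub, hne, hcell, hcover⟩ := exists_cell_enumeration α f D
  set S : Fin n → Set (ℝ × E) := fun k => {p | cellLabel α f D p = c k} with hSdef
  have hSm : ∀ k, MeasurableSet (S k) := fun k => measurableSet_cell α hX.measurable (hsub k)
  have hSd : Pairwise fun j k => Disjoint (S j) (S k) := by
    intro i j hij
    rw [Set.disjoint_left]
    intro p (hp : _ = c i) (hp' : _ = c j)
    exact hij (hinj (hp.symm.trans hp'))
  have hSfin : ∀ k, intensity ν (S k) ≠ ∞ := by
    intro k
    obtain ⟨d, hd⟩ := hne k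
    have hle : S k ⊆ exceedance α (f d.1) d.2 := by
      intro p hp
      have : d ∈ cellLabel α f D p := by rw [hp]; exact hd
      exact (mem_cellLabel.1 this).2
    refine ne_top_of_le_ne_top ?_ (measure_mono hle)
    rw [hX.intensity_exceedance d.1 (hD d (hsub k hd))]
    exact ENNReal.ofReal_ne_top
  set q : Fin n → ℝ := fun k => 1 - Real.exp (-(intensity ν (S k)).toReal) with hqdef
  have hq01 : ∀ j, 0 ≤ q j ∧ q j ≤ 1 := fun j =>
    ⟨sub_nonneg.2 (Real.exp_le_one_iff.2 (by simp)), by simp [hqdef, Real.exp_nonneg]⟩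
  set ε : Fin n → Ω → Bool := fun k ω => decide (∃ i, (Γ i ω, Y i ω) ∈ S k) with hεdef
  have hexp := integral_eq_bernoulliExp (P := P) (ε := ε)
    (fun k => hX.points.measurable_occupied (hSm k)) (hX.points.iIndepFun_occupied hSm hSd)
    (p := q) fun k => hX.points.real_occupied (hSm k) (hSfin k)
  -- Every point above a threshold of D has a nonempty label and so lies in an enumerated cell; the
  -- occupied cells therefore decide all threshold events.
  have hocc : ∀ᵐ ω ∂P, ∀ d ∈ D, X d.1 ω ≤ d.2 ↔ ∀ k, d ∈ c k → ε k ω = false := by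
    filter_upwards [ae_all_iff.2 hX.ae_le_iff] with ω hω d hd
    rw [hω d.1 d.2]
    simp only [hεdef, decide_eq_false_iff_not, not_exists]
    constructor
    · intro h k hk i (hi : _ = c k)
      rw [← hi] at hk
      exact h i (mem_cellLabel.1 hk).2
    · intro h i hi
      have hmem : d ∈ cellLabel α f D (Γ i ω, Y i ω) := mem_cellLabel.2 ⟨hd, hi⟩
      obtain ⟨k, hk⟩ := hcover _ ⟨d, hmem⟩
      exact h k (hk ▸ hmem) i hk.symm
  have hFA : ∀ᵐ ω ∂P, occupationIndicator X D₁ c A (fun k => ε k ω) = A.indicator 1 ω := by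
    filter_upwards [hocc] with ω hω
    exact occupationIndicator_eq_indicator hAD fun d hd => hω d (Finset.mem_union_left _ hd)
  have hFB : ∀ᵐ ω ∂P, occupationIndicator X D₂ c B (fun k => ε k ω) = B.indicator 1 ω := by
    filter_upwards [hocc] with ω hω
    exact occupationIndicator_eq_indicator hBD fun d hd => hω d (Finset.mem_union_right _ hd)
  have hPA : bernoulliExp q (occupationIndicator X D₁ c A) = P.real A := by
    rw [← hexp, integral_congr_ae hFA, integral_indicator_one hA]
  have hPB : bernoulliExp q (occupationIndicator X D₂ c B) = P.real B := by
    rw [← hexp, integral_congr_ae hFB, integral_indicator_one hB]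
  have hPAB : bernoulliExp q (fun e => occupationIndicator X D₁ c A e *
      occupationIndicator X D₂ c B e) = P.real (A ∩ B) := by
    rw [← hexp, ← integral_indicator_one (hA.inter hB)]
    refine integral_congr_ae ?_
    filter_upwards [hFA, hFB] with ω h1 h2
    rw [h1, h2, inter_indicator_one, Pi.mul_apply]
  have hcov := abs_bernoulli_covariance_le hq01
    (fun t k e => influence_mem D₁ c t k e) (fun t k e => influence_mem D₂ c t k e)
    (abs_occupationIndicator_sub_le X D₁ c A) (abs_occupationIndicator_sub_le X D₂ c B)
  rw [hPA, hPB, hPAB] at hcov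
  refine hcov.trans ?_
  simp_rw [Finset.mul_sum]
  rw [Finset.sum_comm]
  refine Finset.sum_le_sum fun s _ => ?_
  rw [Finset.sum_comm]
  refine Finset.sum_le_sum fun t _ => ?_
  set U : Fin n → ℝ := fun k => bernoulliExp q (influence D₁ c s k)
  set V : Fin n → ℝ := fun k => bernoulliExp q (influence D₂ c t k)
  have hU0 : ∀ k, 0 ≤ U k := fun k =>
    bernoulliExp_nonneg hq01 fun e => (influence_mem D₁ c s k e).1
  have hV0 : ∀ k, 0 ≤ V k := fun k =>
    bernoulliExp_nonneg hq01 fun e => (influence_mem D₂ c t k e).1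
  have hterm : ∀ k, ENNReal.ofReal (q k * (1 - q k) * min (U k) (V k))
      ≤ ∫⁻ p in S k, ENNReal.ofReal (pairWeight C α (f s) (f t) p) ∂(intensity ν) := by
    intro k
    rcases hX.influence_bound hD Finset.subset_union_left hinj hsub hcell hcover s k
      (q := q) (fun _ => rfl) with hu | ⟨ξ, hξ, hsξ, hu⟩
    · have : min (U k) (V k) = 0 := by
        rw [show U k = 0 from hu]
        exact min_eq_left (hV0 k)
      simp [this]
    rcases hX.influence_bound hD Finset.subset_union_right hinj hsub hcell hcover t k
      (q := q) (fun _ => rfl) with hv | ⟨η, hη, htη, hv⟩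
    · have : min (U k) (V k) = 0 := by
        rw [show V k = 0 from hv]
        exact min_eq_right (hU0 k)
      simp [this]
    rw [hX.integral_rpow_eq hs] at hu hv
    rw [mul_assoc]
    refine hX.ofReal_cell_le (hSm k) hC.le hξ hη hsξ htη rfl ?_
    rw [mul_min_of_nonneg _ _ (sub_nonneg.2 (hq01 k).2)]
    exact min_le_min hu hv
  have hsum : ENNReal.ofReal (∑ k, q k * (1 - q k) * min (U k) (V k))
      ≤ ENNReal.ofReal ((∫ y, min (f s y ^ α) (f t y ^ α) ∂ν) / C) := by
    rw [ENNReal.ofReal_sum_of_nonneg fun k _ => mul_nonneg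
      (mul_nonneg (hq01 k).1 (sub_nonneg.2 (hq01 k).2)) (le_min (hU0 k) (hV0 k))]
    refine (Finset.sum_le_sum fun k _ => hterm k).trans ?_
    -- The cells are disjoint, so their integrals add up to at most the integral over the whole
    -- space.
    rw [← tsum_fintype (L := .unconditional _), ← lintegral_iUnion hSm hSd]
    refine (setLIntegral_le_lintegral _ _).trans_eq ?_
    rw [lintegral_pairWeight hC (hX.measurable s) (hX.measurable t) (hX.nonneg s) (hX.nonneg t),
      ← ofReal_integral_eq_lintegral_ofReal, integral_div]
    · exact ((hX.integrable_rpow s).inf (hX.integrable_rpow t)).div_const C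
    · exact Eventually.of_forall fun y => div_nonneg (le_min (Real.rpow_nonneg (hX.nonneg _ _) _)
        (Real.rpow_nonneg (hX.nonneg _ _) _)) hC.le
  refine (ENNReal.ofReal_le_ofReal_iff ?_).1 hsum
  exact div_nonneg (integral_nonneg fun y => le_min (Real.rpow_nonneg (hX.nonneg _ _) _)
    (Real.rpow_nonneg (hX.nonneg _ _) _)) hC.le

end IsMaxStableProcess

/-! ### Approximation by threshold events and the mixing rate -/

section Determined

variable {Ω : Type*} {X : ℤ → Ω → ℝ}

/-- The events in `σ(X_t, t ∈ C)` that are determined by finitely many of the events `{X_t ≤ x}`,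
`t ∈ C`, `x > 0`. -/
def finiteThresholdEvents (X : ℤ → Ω → ℝ) (C : Set ℤ) : Set (Set Ω) :=
  {A | MeasurableSet[sigmaField X C] A ∧
    ∃ D : Finset (ℤ × ℝ), (∀ d ∈ D, d.1 ∈ C ∧ 0 < d.2) ∧ IsDeterminedBy X D A}

theorem IsDeterminedBy.mono {D D' : Finset (ℤ × ℝ)} {A : Set Ω} (h : IsDeterminedBy X D A)
    (hD : D ⊆ D') : IsDeterminedBy X D' A :=
  fun ω ω' hω => h ω ω' fun d hd => hω d (hD hd)

theorem isSetRing_finiteThresholdEvents (C : Set ℤ) :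
    IsSetRing (finiteThresholdEvents X C) := by
  classical
  have hunion : ∀ {D D' : Finset (ℤ × ℝ)}, (∀ d ∈ D, d.1 ∈ C ∧ 0 < d.2) →
      (∀ d ∈ D', d.1 ∈ C ∧ 0 < d.2) → ∀ d ∈ D ∪ D', d.1 ∈ C ∧ 0 < d.2 := fun h h' d hd =>
    (Finset.mem_union.1 hd).elim (h d) (h' d)
  refine ⟨⟨@MeasurableSet.empty _ (sigmaField X C), ∅, by simp, fun _ _ _ => by simp⟩, ?_, ?_⟩
  · rintro A B ⟨hA, D, hD, hAD⟩ ⟨hB, D', hD', hBD⟩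
    refine ⟨hA.union hB, D ∪ D', hunion hD hD', fun ω ω' h => ?_⟩
    rw [mem_union, mem_union, hAD.mono Finset.subset_union_left ω ω' h,
      hBD.mono Finset.subset_union_right ω ω' h]
  · rintro A B ⟨hA, D, hD, hAD⟩ ⟨hB, D', hD', hBD⟩
    refine ⟨hA.diff hB, D ∪ D', hunion hD hD', fun ω ω' h => ?_⟩
    rw [Set.mem_sdiff, Set.mem_sdiff, hAD.mono Finset.subset_union_left ω ω' h,
      hBD.mono Finset.subset_union_right ω ω' h]

theorem measurable_sigmaField {C : Set ℤ} {t : ℤ} (ht : t ∈ C) :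
    Measurable[sigmaField X C, borel ℝ] (X t) := by
  rw [measurable_iff_comap_le]
  exact le_iSup₂ (f := fun t (_ : t ∈ C) => MeasurableSpace.comap (X t) (borel ℝ)) t ht

/-- Positive thresholds suffice since the process is nonnegative: {X_t ≤ x} is empty for x < 0, and
{X_t ≤ 0} is the intersection of the events {X_t ≤ 1/(n+1)}. -/
theorem sigmaField_eq_generateFrom (h0 : ∀ t ω, 0 ≤ X t ω) (C : Set ℤ) :
    sigmaField X C = MeasurableSpace.generateFrom (finiteThresholdEvents X C) := by
  refine le_antisymm (iSup₂_le fun t ht => ?_)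
    (MeasurableSpace.generateFrom_le fun A hA => hA.1)
  have hpos : ∀ x : ℝ, 0 < x → MeasurableSet[MeasurableSpace.generateFrom
      (finiteThresholdEvents X C)] (X t ⁻¹' Iic x) := by
    intro x hx
    refine MeasurableSpace.measurableSet_generateFrom
      ⟨measurable_sigmaField ht (borel_eq_generateFrom_Iic ℝ ▸
        MeasurableSpace.measurableSet_generateFrom ⟨x, rfl⟩), {(t, x)}, by simp [ht, hx],
        fun ω ω' h => ?_⟩
    exact h (t, x) (Finset.mem_singleton_self _)
  rw [borel_eq_generateFrom_Iic, MeasurableSpace.comap_generateFrom]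
  refine MeasurableSpace.generateFrom_le ?_
  rintro _ ⟨_, ⟨x, rfl⟩, rfl⟩
  rcases lt_or_ge 0 x with hx | hx
  · exact hpos x hx
  rcases hx.lt_or_eq with hx | rfl
  · have : X t ⁻¹' Iic x = ∅ := by
      ext ω
      simpa using hx.trans_le (h0 t ω)
    rw [this]
    exact @MeasurableSet.empty _ (MeasurableSpace.generateFrom _)
  · have : X t ⁻¹' Iic 0 = ⋂ n : ℕ, X t ⁻¹' Iic (1 / ((n : ℝ) + 1)) := by
      ext ω
      simp only [mem_preimage, mem_Iic, mem_iInter]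
      refine ⟨fun h n => h.trans (by positivity), fun h => ?_⟩
      exact ge_of_tendsto' tendsto_one_div_add_atTop_nhds_zero_nat h
    rw [this]
    exact @MeasurableSet.iInter _ _ (MeasurableSpace.generateFrom _) _ _ fun n =>
      hpos _ (by positivity)

end Determined

/-- P(A ∩ B) and P(A) P(B) each move by at most the sum of the two symmetric differences, hence the
factor 2. -/
theorem abs_real_inter_sub_le_add {Ω : Type*} [MeasurableSpace Ω] {P : Measure Ω}
    [IsProbabilityMeasure P] {A B A' B' : Set Ω} (hA : MeasurableSet A) (hB : MeasurableSet B)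
    (hA' : MeasurableSet A') (hB' : MeasurableSet B') :
    |P.real (A ∩ B) - P.real A * P.real B| ≤
      |P.real (A' ∩ B') - P.real A' * P.real B'|
        + 2 * (P.real (symmDiff A' A) + P.real (symmDiff B' B)) := by
  have h1 := abs_measureReal_sub_le_measureReal_symmDiff (μ := P) hA'.nullMeasurableSet
    hA.nullMeasurableSet
  have h2 := abs_measureReal_sub_le_measureReal_symmDiff (μ := P) hB'.nullMeasurableSet
    hB.nullMeasurableSet
  have h3 := abs_measureReal_sub_le_measureReal_symmDiff (μ := P)
    (hA'.inter hB').nullMeasurableSet (hA.inter hB).nullMeasurableSet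
  have h4 : P.real (symmDiff (A' ∩ B') (A ∩ B)) ≤ P.real (symmDiff A' A) + P.real (symmDiff B' B) :=
    (measureReal_mono (by
      intro ω
      simp only [Set.mem_symmDiff, mem_inter_iff, mem_union]
      tauto)).trans (measureReal_union_le _ _)
  have h5 : |P.real A' * P.real B' - P.real A * P.real B|
      ≤ P.real (symmDiff A' A) + P.real (symmDiff B' B) := by
    have e : P.real A' * P.real B' - P.real A * P.real B
        = (P.real A' - P.real A) * P.real B' + P.real A * (P.real B' - P.real B) := by ring
    rw [e]
    refine (abs_add_le _ _).trans (add_le_add ?_ ?_)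
    · rw [abs_mul, abs_of_nonneg (measureReal_nonneg (s := B'))]
      exact (mul_le_of_le_one_right (abs_nonneg _) measureReal_le_one).trans h1
    · rw [abs_mul, abs_of_nonneg (measureReal_nonneg (s := A))]
      exact (mul_le_of_le_one_left (abs_nonneg _) measureReal_le_one).trans h2
  rw [abs_le] at h3 h5
  have h6 := le_abs_self (P.real (A' ∩ B') - P.real A' * P.real B')
  have h7 := neg_abs_le (P.real (A' ∩ B') - P.real A' * P.real B')
  refine abs_le.2 ⟨?_, ?_⟩ <;> linarith [h3.1, h3.2, h5.1, h5.2]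

namespace IsMaxStableProcess

variable {E Ω : Type*} [MeasurableSpace E] [mΩ : MeasurableSpace Ω] {ν : Measure E} [SigmaFinite ν]
  {P : Measure Ω} [IsProbabilityMeasure P] {α : ℝ} {Γ : ℕ → Ω → ℝ} {Y : ℕ → Ω → E}
  {f : ℤ → E → ℝ} {X : ℤ → Ω → ℝ}

theorem sigmaField_le (hX : IsMaxStableProcess ν P α Γ Y f X) (C : Set ℤ) :
    sigmaField X C ≤ mΩ := by
  refine iSup₂_le fun t _ => ?_
  rw [← measurable_iff_comap_le]
  exact hX.measurable_process t

theorem exists_finiteThresholdEvent (hX : IsMaxStableProcess ν P α Γ Y f X) {C : Set ℤ}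
    {A : Set Ω} (hA : MeasurableSet[sigmaField X C] A) {δ : ℝ} (hδ : 0 < δ) :
    ∃ A' ∈ finiteThresholdEvents X C, P.real (symmDiff A' A) < δ := by
  have hle := hX.sigmaField_le C
  have : IsFiniteMeasure (P.trim hle) := isFiniteMeasure_trim hle
  -- The ring generates `sigmaField X C` only, so the density theorem is applied to the trimmed
  -- measure. The ring contains the whole space, which provides the required countable cover.
  obtain ⟨A', hA', h⟩ := @exists_measure_symmDiff_lt_of_generateFrom_isSetRing
    Ω (sigmaField X C) (P.trim hle) this _
    (isSetRing_finiteThresholdEvents (X := X) C)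
    ⟨{univ}, countable_singleton _, singleton_subset_iff.2
      ⟨@MeasurableSet.univ _ (sigmaField X C), ∅, by simp, fun _ _ _ => by simp⟩, by simp⟩
    (sigmaField_eq_generateFrom hX.process_nonneg C) _ hA _ (ENNReal.ofReal_pos.2 hδ)
  refine ⟨A', hA', ?_⟩
  rw [trim_measurableSet_eq hle (MeasurableSet.symmDiff hA'.1 hA)] at h
  rw [measureReal_def]
  exact (ENNReal.lt_ofReal_iff_toReal_lt (measure_ne_top _ _)).1 h

/-- By stationarity the term of (s, t) depends on t - s only; s₁ = s and s₂ = t - h embed the finite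
sum injectively into the double series. -/
theorem sum_pair_le_tsum (hX : IsMaxStableProcess ν P α Γ Y f X) (hs : IsStrictlyStationary P X)
    (hC : 0 < ∫ y, f 0 y ^ α ∂ν) (h : ℕ) {T₁ T₂ : Finset ℤ} (hT₁ : ∀ s ∈ T₁, s ≤ 0)
    (hT₂ : ∀ t ∈ T₂, (h : ℤ) ≤ t) :
    ENNReal.ofReal (∑ s ∈ T₁, ∑ t ∈ T₂,
        (∫ y, min (f s y ^ α) (f t y ^ α) ∂ν) / ∫ y, f 0 y ^ α ∂ν)
      ≤ ∑' (s₁ : Iic (0 : ℤ)) (s₂ : Ici (0 : ℤ)),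
        ENNReal.ofReal ((∫ y, min (f 0 y ^ α) (f ((h : ℤ) + s₂ - s₁) y ^ α) ∂ν) /
          ∫ y, f 0 y ^ α ∂ν) := by
  classical
  have hnn : ∀ s t, 0 ≤ (∫ y, min (f s y ^ α) (f t y ^ α) ∂ν) / ∫ y, f 0 y ^ α ∂ν := fun s t =>
    div_nonneg (integral_nonneg fun y => le_min (Real.rpow_nonneg (hX.nonneg _ _) _)
      (Real.rpow_nonneg (hX.nonneg _ _) _)) hC.le
  have hsum : ∀ {S : Set ℤ} {T : Finset ℤ} (_ : ∀ s ∈ T, s ∈ S) (φ : ℤ → ℝ≥0∞),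
      ∑ s ∈ T, φ s ≤ ∑' s : S, φ s := by
    intro S T hT φ
    rw [← Finset.tsum_subtype T φ]
    exact ENNReal.tsum_mono_subtype φ fun s hs => hT s hs
  rw [ENNReal.ofReal_sum_of_nonneg fun s _ => Finset.sum_nonneg fun t _ => hnn s t]
  refine le_trans (Finset.sum_le_sum fun s _ => ?_) (hsum (S := Iic 0) (fun s hs => hT₁ s hs)
    fun s₁ => ∑' s₂ : Ici (0 : ℤ), ENNReal.ofReal
      ((∫ y, min (f 0 y ^ α) (f ((h : ℤ) + s₂ - s₁) y ^ α) ∂ν) / ∫ y, f 0 y ^ α ∂ν))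
  rw [ENNReal.ofReal_sum_of_nonneg fun t _ => hnn s t]
  have hshift : ∀ t ∈ T₂.image (fun t => t - (h : ℤ)), t ∈ Ici (0 : ℤ) := by
    intro t ht
    obtain ⟨t', ht', rfl⟩ := Finset.mem_image.1 ht
    exact sub_nonneg.2 (hT₂ t' ht')
  refine le_trans ?_ (hsum hshift fun s₂ => ENNReal.ofReal
    ((∫ y, min (f 0 y ^ α) (f ((h : ℤ) + s₂ - s) y ^ α) ∂ν) / ∫ y, f 0 y ^ α ∂ν))
  rw [Finset.sum_image fun a _ b _ hab => by simpa using hab]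
  refine Finset.sum_le_sum fun t _ => ?_
  rw [hX.integral_min_shift hs s t, add_sub_cancel]

/-- The bound of the mixing rate of a stationary max-stable process. -/
theorem mixingRate_le (hX : IsMaxStableProcess ν P α Γ Y f X) (hs : IsStrictlyStationary P X)
    (hC : 0 < ∫ y, f 0 y ^ α ∂ν) (h : ℕ) :
    mixingRate P X h ≤ ∑' (s₁ : Iic (0 : ℤ)) (s₂ : Ici (0 : ℤ)),
      ENNReal.ofReal ((∫ y, min (f 0 y ^ α) (f ((h : ℤ) + s₂ - s₁) y ^ α) ∂ν) /
        ∫ y, f 0 y ^ α ∂ν) := by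
  classical
  refine iSup₂_le fun A hA => iSup₂_le fun B hB => ?_
  refine ENNReal.le_of_forall_pos_le_add fun δ hδ _ => ?_
  -- Two approximations, each within δ/4 and counted twice, cost δ in total.
  have hδ4 : (0 : ℝ) < δ / 4 := by positivity
  obtain ⟨A', ⟨hA', D₁, hD₁, hAD⟩, hAA⟩ := hX.exists_finiteThresholdEvent hA hδ4
  obtain ⟨B', ⟨hB', D₂, hD₂, hBD⟩, hBB⟩ := hX.exists_finiteThresholdEvent hB hδ4
  have hle₁ := hX.sigmaField_le (Iic 0)
  have hle₂ := hX.sigmaField_le (Ici (h : ℤ))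
  have h1 := abs_real_inter_sub_le_add (P := P) (hle₁ _ hA) (hle₂ _ hB) (hle₁ _ hA') (hle₂ _ hB')
  have h2 := hX.abs_real_inter_sub_le hs hC (fun d hd => (hD₁ d hd).2) (fun d hd => (hD₂ d hd).2)
    (hle₁ _ hA') (hle₂ _ hB') hAD hBD
  have h3 := hX.sum_pair_le_tsum hs hC h (T₁ := D₁.image Prod.fst) (T₂ := D₂.image Prod.fst)
    (fun s hs => by obtain ⟨d, hd, rfl⟩ := Finset.mem_image.1 hs; exact (hD₁ d hd).1)
    (fun t ht => by obtain ⟨d, hd, rfl⟩ := Finset.mem_image.1 ht; exact (hD₂ d hd).1)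
  refine (ENNReal.ofReal_le_ofReal (q := _ + (δ : ℝ)) (h1.trans
    (add_le_add h2 (by linarith)))).trans ?_
  refine ENNReal.ofReal_add_le.trans (add_le_add h3 ?_)
  rw [ENNReal.ofReal_coe_nnreal]

end IsMaxStableProcess

end MaxStable

theorem proposition1 :
    -- the constant of part (4) is universal
    ∃ c : ℝ, 0 < c ∧
    ∀ {E Ω : Type*} [MeasurableSpace E] [MeasurableSpace Ω]
      (ν : Measure E) [SigmaFinite ν] (P : Measure Ω) [IsProbabilityMeasure P]
      (α : ℝ) (_ : 0 < α)
      (Γ : ℕ → Ω → ℝ) (Y : ℕ → Ω → E) (_ : MaxStable.IsPoissonPoints P ν Γ Y)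
      (f : ℤ → E → ℝ) (_ : ∀ t, Measurable (f t)) (_ : ∀ t y, 0 ≤ f t y)
      (_ : ∀ t, MemLp (f t) (ENNReal.ofReal α) ν)
      (_ : 0 < ∫ y, f 0 y ^ α ∂ν)
      (X : ℤ → Ω → ℝ) (_ : ∀ t ω, X t ω = MaxStable.maxStableIntegral α Γ Y (f t) ω)
      (_ : MaxStable.IsStrictlyStationary P X),
      -- (1) regular variation and the limit measures
      (∃ μ : ∀ h : ℕ, Measure (MaxStable.Punctured h),
        MaxStable.IsRegularlyVarying P X α μ ∧
        ∀ (h : ℕ), 1 ≤ h → ∀ x : Fin h → ℝ, (∀ i, 0 < x i) →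
          μ h {y | ¬ ∀ i, 0 ≤ y.1 i ∧ y.1 i ≤ (x i : EReal)} =
            ENNReal.ofReal ((∫ y, (⨆ i : Fin h, (f ((i : ℤ) + 1) y / x i) ^ α) ∂ν) /
              ∫ y, f 0 y ^ α ∂ν)) ∧
      -- (2) the extremal index
      (∀ θ : ℝ, MaxStable.HasExtremalIndex P X θ ↔
        Tendsto (fun n : ℕ => 1 / (n : ℝ) *
          ((∫ y, (⨆ t : Fin n, f ((t : ℤ) + 1) y ^ α) ∂ν) / ∫ y, f 0 y ^ α ∂ν))
          atTop (𝓝 θ)) ∧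
      -- (3) the extremogram and the tail dependence coefficients
      (∀ a b : ℝ, 0 < a → 0 < b → ∀ h : ℕ,
        MaxStable.HasExtremogram P X (Ioi a) (Ioi b) h
          ((∫ y, min (f 0 y ^ α) ((a / b * f h y) ^ α) ∂ν) / (a ^ α * ∫ y, f 0 y ^ α ∂ν))) ∧
      (∀ h : ℕ, 1 ≤ h →
        MaxStable.HasTailDependence P X h
          ((∫ y, min (f 0 y ^ α) (f h y ^ α) ∂ν) / ∫ y, f 0 y ^ α ∂ν)) ∧
      -- (4) the mixing rate
      (∀ h : ℕ, 1 ≤ h →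
        MaxStable.mixingRate P X h ≤
          ENNReal.ofReal c * ∑' (s₁ : Iic (0 : ℤ)) (s₂ : Ici (0 : ℤ)),
            ENNReal.ofReal ((∫ y, min (f 0 y ^ α) (f ((h : ℤ) + s₂ - s₁) y ^ α) ∂ν) /
              ∫ y, f 0 y ^ α ∂ν)) := by

  -- The covariance argument loses no constant, so c = 1 works.
  refine ⟨1, one_pos, ?_⟩
  intro E Ω _ _ ν _ P _ α hα Γ Y hpts f hfm hf0 hfL hC X hXeq hs
  have hX : MaxStable.IsMaxStableProcess ν P α Γ Y f X := ⟨hα, hpts, hfm, hf0, hfL, hXeq⟩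
  refine ⟨⟨_, hX.isRegularlyVarying hs hC, fun h _ x hx => ?_⟩,
    fun θ => hX.hasExtremalIndex_iff hs hC θ, fun a b ha hb h => hX.hasExtremogram hC ha hb h,
    fun h _ => hX.hasTailDependence hC h, fun h _ => ?_⟩
  · rw [MaxStable.puncturedMeasure_compl_rectangle (hX.ae_limitMeasure_nonneg h) hx,
      hX.limitMeasure_upperTail hC hx]
    rfl
  · rw [ENNReal.ofReal_one, one_mul]
    exact hX.mixingRate_le hs hC h
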